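/- Let $M$ be a smooth (Hausdorff) manifold without boundary and let $Q$ be a quaternionic structure on $M$: $Q\subset \mathrm{End}(TM)$ is a smooth subbundle of rank $3$ which at every point is spanned by endomorphisms $I_1,I_2,I_3$ with $I_1^2=I_2^2=I_3^2=-\mathrm{id}$ and $I_1I_2=-I_2I_1=I_3$, and there exists a quaternionic connection on $(M,Q)$, that is, a torsion-free connection $\nabla$ on $TM$ such that the induced connection on $\mathrm{End}(TM)$ satisfies $\nabla_Y\Gamma(Q)\subset\Gamma(Q)$ for all vector fields $Y$. Let $X$ be a quaternionic vector field on $(M,Q)$, that is, a smooth vector field whose local flow $\varphi_t$ satisfies $(\varphi_t)_*\circ I\circ(\varphi_t)_*^{-1}\in Q$ for all $I\in Q$ and all $t$ for which it is defined. If there exists a volume element $\nu$ on $M$ (a smooth nowhere vanishing differential form of top degree) such that $L_X\nu=0$, then there exists a quaternionic connection $\nabla$ on $(M,Q)$ such that $L_X\nabla=0$, where $$(L_X\nabla)_YZ=[X,\nabla_YZ]-\nabla_{[X,Y]}Z-\nabla_Y[X,Z]$$ for all smooth vector fields $Y,Z$ on $M$. -/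

import Mathlib

open Set Bundle VectorField
open scoped Manifold ContDiff Topology

noncomputable section

namespace Quaternionic

/-! Throughout, `M` is a smooth manifold without boundary, modelled on the finite-dimensional real
vector space `E`. -/

/-- The fibre `End(T_x M)` of the endomorphism bundle of the tangent bundle. -/
abbrev EndT (E : Type*) [NormedAddCommGroup E] [NormedSpace ℝ E]
    {M : Type*} [TopologicalSpace M] [ChartedSpace E M] (x : M) : Type _ :=
  TangentSpace 𝓘(ℝ, E) x →L[ℝ] TangentSpace 𝓘(ℝ, E) x

/-- A connection on `M`, that is, a connection on the tangent bundle of `M`.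
The value `D Y x v` is `(∇_v Y)(x)`, for `v` in `T_x M`. -/
abbrev Connection (E : Type*) [NormedAddCommGroup E] [NormedSpace ℝ E]
    (M : Type*) [TopologicalSpace M] [ChartedSpace E M] [IsManifold 𝓘(ℝ, E) ∞ M] : Type _ :=
  CovariantDerivative 𝓘(ℝ, E) E (fun x : M ↦ TangentSpace 𝓘(ℝ, E) x)

variable {E : Type*} [NormedAddCommGroup E] [NormedSpace ℝ E] [FiniteDimensional ℝ E]
  {M : Type*} [TopologicalSpace M] [ChartedSpace E M] [IsManifold 𝓘(ℝ, E) ∞ M]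

/-- Smoothness of a vector field on `M`. -/
def SmoothVF (X : Π x : M, TangentSpace 𝓘(ℝ, E) x) : Prop :=
  ContMDiff 𝓘(ℝ, E) (𝓘(ℝ, E).prod 𝓘(ℝ, E)) ∞
    (fun x ↦ TotalSpace.mk' E (E := fun x : M ↦ TangentSpace 𝓘(ℝ, E) x) x (X x))

/-- Smoothness on `U` of a section of the vector bundle `End(TM)`. -/
def SmoothEndOn (A : Π x : M, EndT E x) (U : Set M) : Prop :=
  ContMDiffOn 𝓘(ℝ, E) (𝓘(ℝ, E).prod 𝓘(ℝ, E →L[ℝ] E)) ∞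
    (fun x ↦ TotalSpace.mk' (E →L[ℝ] E) (E := fun x : M ↦ EndT E x) x (A x)) U

/-! ### The induced connection on `End(TM)` -/

theorem SmoothEndOn.mdifferentiableAt_apply {A : Π x : M, EndT E x} (hA : SmoothEndOn A univ)
    {x : M} {Y : Π y : M, TangentSpace 𝓘(ℝ, E) y} (hY : MDiffAt (T% Y) x) :
    MDiffAt (T% (fun y ↦ A y (Y y))) x := by
  have h := (hA x (mem_univ x)).contMDiffAt Filter.univ_mem
  exact (h.mdifferentiableAt (by simp)).clm_bundle_apply hY

/-- The operator `Y ↦ ∇_v (A Y) - A (∇_v Y)` is tensorial in `Y`. -/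
theorem endDeriv_tensorial (D : Connection E M) {A : Π x : M, EndT E x}
    (hA : SmoothEndOn A univ) (x : M) (v : TangentSpace 𝓘(ℝ, E) x) :
    TensorialAt 𝓘(ℝ, E) E
      (fun Y : Π y : M, TangentSpace 𝓘(ℝ, E) y ↦ D (fun y ↦ A y (Y y)) x v - A x (D Y x v)) x where
  smul {f Y} hf hY := by
    have h1 : (fun y ↦ A y ((f • Y) y)) = f • (fun y ↦ A y (Y y)) := by
      funext y; simp
    rw [h1, D.isCovariantDerivativeOnUniv.leibniz (hA.mdifferentiableAt_apply hY) hf,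
      D.isCovariantDerivativeOnUniv.leibniz hY hf]
    simp [smul_sub]
  add {Y Y'} hY hY' := by
    have h1 : (fun y ↦ A y ((Y + Y') y)) = (fun y ↦ A y (Y y)) + (fun y ↦ A y (Y' y)) := by
      funext y; simp
    rw [h1, D.isCovariantDerivativeOnUniv.add (hA.mdifferentiableAt_apply hY)
      (hA.mdifferentiableAt_apply hY'), D.isCovariantDerivativeOnUniv.add hY hY']
    simp only [add_apply, map_add]
    abel

/-- The connection on `End(TM)` induced by `∇`: `(∇_v A) Y = ∇_v (A Y) - A (∇_v Y)`,
for a smooth section `A` of `End(TM)` and `v` in `T_x M`. -/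
def endDeriv (D : Connection E M) (A : Π x : M, EndT E x) (hA : SmoothEndOn A univ) (x : M)
    (v : TangentSpace 𝓘(ℝ, E) x) : EndT E x :=
  TensorialAt.mkHom _ x (endDeriv_tensorial D hA x v)

theorem endDeriv_apply (D : Connection E M) {A : Π x : M, EndT E x} (hA : SmoothEndOn A univ)
    {x : M} (v : TangentSpace 𝓘(ℝ, E) x) {Y : Π y : M, TangentSpace 𝓘(ℝ, E) y}
    (hY : MDiffAt (T% Y) x) :
    endDeriv D A hA x v (Y x) = D (fun y ↦ A y (Y y)) x v - A x (D Y x v) :=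
  TensorialAt.mkHom_apply (endDeriv_tensorial D hA x v) hY

/-! ### Quaternionic manifolds -/

/-- `Q` is a smooth subbundle of rank 3 of `End(TM)` which at every point is spanned by
endomorphisms `I₁`, `I₂`, `I₃` satisfying the quaternionic relations. -/
structure IsAlmostQuaternionic (Q : Π x : M, Submodule ℝ (EndT E x)) : Prop where
  rank_eq : ∀ x, Module.finrank ℝ (Q x) = 3
  smooth : ∀ x₀ : M, ∃ U : Set M, IsOpen U ∧ x₀ ∈ U ∧
    ∃ A : Fin 3 → Π x : M, EndT E x, (∀ i, SmoothEndOn (A i) U) ∧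
      ∀ x ∈ U, Q x = Submodule.span ℝ (range fun i ↦ A i x)
  admissible : ∀ x : M, ∃ I₁ I₂ I₃ : EndT E x,
    I₁ ∘L I₁ = -ContinuousLinearMap.id ℝ _ ∧ I₂ ∘L I₂ = -ContinuousLinearMap.id ℝ _ ∧
    I₃ ∘L I₃ = -ContinuousLinearMap.id ℝ _ ∧ I₁ ∘L I₂ = I₃ ∧ I₂ ∘L I₁ = -I₃ ∧
    Q x = Submodule.span ℝ {I₁, I₂, I₃}

/-- `∇` is a quaternionic connection for `Q`: a smooth torsion-free connection on `M`
that maps sections of `Q` to sections of `Q`. -/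
structure IsQuaternionicConnection (Q : Π x : M, Submodule ℝ (EndT E x))
    (D : Connection E M) : Prop where
  smooth : CovariantDerivative.ContMDiffCovariantDerivative D ∞
  torsion_free : D.torsion = 0
  preserves : ∀ (A : Π x : M, EndT E x) (hA : SmoothEndOn A univ), (∀ x, A x ∈ Q x) →
    ∀ (x : M) (v : TangentSpace 𝓘(ℝ, E) x), endDeriv D A hA x v ∈ Q x

/-- `Q` is a quaternionic structure on `M`, that is, `(M, Q)` is a quaternionic manifold. -/
structure IsQuaternionicStructure (Q : Π x : M, Submodule ℝ (EndT E x)) : Prop where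
  almost : IsAlmostQuaternionic Q
  exists_connection : ∃ D : Connection E M, IsQuaternionicConnection Q D

/-! ### Quaternionic vector fields -/

/-- `φ` (with `φ t x = φ_t(x)`) is the local flow of `X` for times `|t| < ε` and initial points in
the open set `U`. -/
structure IsLocalFlow (X : Π x : M, TangentSpace 𝓘(ℝ, E) x) (φ : ℝ → M → M) (ε : ℝ)
    (U : Set M) : Prop where
  pos : 0 < ε
  isOpen : IsOpen U
  smooth : ContMDiffOn (𝓘(ℝ, ℝ).prod 𝓘(ℝ, E)) 𝓘(ℝ, E) ∞ (fun p : ℝ × M ↦ φ p.1 p.2)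
    (Ioo (-ε) ε ×ˢ U)
  zero : ∀ x ∈ U, φ 0 x = x
  integralCurve : ∀ x ∈ U, IsMIntegralCurveOn (fun t ↦ φ t x) X (Ioo (-ε) ε)

/-- `X` is a quaternionic vector field: its local flow `φ_t` satisfies
`dφ_t ∘ A ∘ (dφ_t)⁻¹ ∈ Q` for all `A ∈ Q`. The endomorphism `dφ_t ∘ A ∘ (dφ_t)⁻¹` of the tangent
space at `φ_t(x)` is the `B` with `B ∘ dφ_t = dφ_t ∘ A`, as `dφ_t` is invertible. -/
structure IsQuaternionicVF (Q : Π x : M, Submodule ℝ (EndT E x))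
    (X : Π x : M, TangentSpace 𝓘(ℝ, E) x) : Prop where
  smooth : SmoothVF X
  flow : ∀ x₀ : M, ∃ (φ : ℝ → M → M) (ε : ℝ) (U : Set M), x₀ ∈ U ∧ IsLocalFlow X φ ε U ∧
    ∀ t ∈ Ioo (-ε) ε, ∀ x ∈ U, ∀ A ∈ Q x, ∃ B ∈ Q (φ t x),
      B ∘L mfderiv 𝓘(ℝ, E) 𝓘(ℝ, E) (φ t) x = mfderiv 𝓘(ℝ, E) 𝓘(ℝ, E) (φ t) x ∘L A

/-! ### Lie derivatives -/

/-- A differential form of top degree (not necessarily smooth) on `M`. -/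
abbrev TopForm (E : Type*) [NormedAddCommGroup E] [NormedSpace ℝ E]
    (M : Type*) [TopologicalSpace M] [ChartedSpace E M] : Type _ :=
  Π x : M, TangentSpace 𝓘(ℝ, E) x [⋀^Fin (Module.finrank ℝ E)]→ₗ[ℝ] ℝ

/-- `ν` is a volume element: a smooth, nowhere vanishing differential form of top degree. -/
structure IsVolumeElement (ν : TopForm E M) : Prop where
  smooth : ∀ Y : Fin (Module.finrank ℝ E) → Π x : M, TangentSpace 𝓘(ℝ, E) x,
    (∀ i, SmoothVF (Y i)) → ContMDiff 𝓘(ℝ, E) 𝓘(ℝ, ℝ) ∞ (fun x ↦ ν x (fun i ↦ Y i x))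
  ne_zero : ∀ x, ν x ≠ 0

/-- The Lie derivative of a form of top degree, evaluated on vector fields:
`(L_X ν)(Y₁, …, Y_m) = X(ν(Y₁, …, Y_m)) - ∑ i, ν(Y₁, …, [X, Y_i], …, Y_m)`. -/
def lieDerivForm (X : Π x : M, TangentSpace 𝓘(ℝ, E) x) (ν : TopForm E M)
    (Y : Fin (Module.finrank ℝ E) → Π x : M, TangentSpace 𝓘(ℝ, E) x) (x : M) : ℝ :=
  mvfderiv 𝓘(ℝ, E) (fun y ↦ ν y (fun i ↦ Y i y)) x (X x)
    - ∑ i, ν x (Function.update (fun j ↦ Y j x) i (mlieBracket 𝓘(ℝ, E) X (Y i) x))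

/-- The Lie derivative of a connection:
`(L_X ∇)_Y Z = [X, ∇_Y Z] - ∇_{[X, Y]} Z - ∇_Y [X, Z]`. -/
def lieDerivConnection (X : Π x : M, TangentSpace 𝓘(ℝ, E) x) (D : Connection E M)
    (Y Z : Π x : M, TangentSpace 𝓘(ℝ, E) x) (x : M) : TangentSpace 𝓘(ℝ, E) x :=
  mlieBracket 𝓘(ℝ, E) X (fun y ↦ D Z y (Y y)) x
    - D Z x (mlieBracket 𝓘(ℝ, E) X Y x)
    - D (mlieBracket 𝓘(ℝ, E) X Z) x (Y x)

end Quaternionic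

end

/-!
Two quaternionic connections differ by a tensor `S^ξ` which is determined by a one-form `ξ`: for a
local admissible basis `I, J, K` of `Q`,
`S^ξ_Y Z = ξ(Y) Z + ξ(Z) Y - ∑_{L = I, J, K} (ξ(L Y) L Z + ξ(L Z) L Y)`.
The reason is linear algebra: a symmetric bilinear map `T` on a tangent space for which every `T_Y`
normalizes `Q` is of this form (`IsQuaternionTriple.eq_correction`). Since
`tr S^ξ_Y = (m + 4) ξ(Y)`, where `m` is the dimension of `M`, such a `T` vanishes as soon as all
the `T_Y` are trace-free.

This is used twice. First, let `D` be any quaternionic connection and write `D_v ν = α(v) ν`. For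
`ξ = α / (m + 4)`, the connection `∇ = D + S^ξ` is again quaternionic
(`IsQuaternionicConnection.addOneForm_correction`), and `ν` is parallel for it
(`IsVolumeElement.parallel_addOneForm_correction`). Secondly, the tensor `T = L_X ∇` vanishes for
this connection (`IsQuaternionicConnection.lieDerivConnection_eq_zero`):

* `T` is symmetric because `∇` is torsion-free, by the Jacobi identity
  (`lieDerivConnection_symm`);
* `T_Y` normalizes `Q`, since
  `[T_Y, A] = L_X (∇_Y A) - ∇_{[X, Y]} A - ∇_Y (L_X A)` and both `∇_Y` and `L_X` preserve the
  sections of `Q` (`lieDerivConnection_commutator`). For `L_X` this is obtained by differentiating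
  `dφ_t⁻¹ ∘ A ∘ dφ_t ∈ Q` along the local flow `φ_t` of `X`
  (`IsQuaternionicVF.chartLieDeriv_mem`);
* `tr T_Y = 0`, since `T_Y` acts on `ν` as the commutator of `L_X` and `∇_Y`, up to `∇_{[X, Y]}`,
  and `ν` is annihilated by all of these (`IsVolumeElement.tr_lieDerivConnection_eq_zero`).

Connections, forms and sections of `Q` are tested on global vector fields and sections, so local frames
are first multiplied with cutoff functions; this is where the Hausdorff property of `M` enters.
-/

set_option linter.unusedSectionVars false

noncomputable section

namespace Quaternionic

/-! ### Linear algebra of quaternionic triples -/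

section

section LinearAlgebra

variable {V : Type*} [AddCommGroup V] [Module ℝ V] [TopologicalSpace V] [IsTopologicalAddGroup V]
  [ContinuousSMul ℝ V]

/-- `(I, J, K)` satisfies the quaternionic relations, stated pointwise. The remaining products
follow from these. -/
structure IsQuaternionTriple (I J K : V →L[ℝ] V) : Prop where
  sq₁ : ∀ z, I (I z) = -z
  sq₂ : ∀ z, J (J z) = -z
  sq₃ : ∀ z, K (K z) = -z
  mul₁₂ : ∀ z, I (J z) = K z
  mul₂₁ : ∀ z, J (I z) = -K z

namespace IsQuaternionTriple

variable {I J K : V →L[ℝ] V}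

theorem mul₂₃ (h : IsQuaternionTriple I J K) (z : V) : J (K z) = I z := by
  rw [← h.mul₁₂, h.mul₂₁, ← h.mul₁₂, h.sq₂, map_neg, neg_neg]

theorem mul₃₂ (h : IsQuaternionTriple I J K) (z : V) : K (J z) = -I z := by
  rw [← h.mul₁₂, h.sq₂, map_neg]

theorem mul₃₁ (h : IsQuaternionTriple I J K) (z : V) : K (I z) = J z := by
  rw [← h.mul₁₂, h.mul₂₁, map_neg, ← h.mul₁₂, h.sq₁, neg_neg]

theorem mul₁₃ (h : IsQuaternionTriple I J K) (z : V) : I (K z) = -J z := by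
  rw [← h.mul₁₂, h.sq₁]

theorem rotate (h : IsQuaternionTriple I J K) : IsQuaternionTriple J K I :=
  ⟨h.sq₂, h.sq₃, h.sq₁, h.mul₂₃, h.mul₃₂⟩

/-- A nonzero vector and its images under `I`, `J`, `K` are linearly independent. -/
theorem eq_zero_of_combination (h : IsQuaternionTriple I J K) {y : V} (hy : y ≠ 0) {a b c d : ℝ}
    (H : a • y + b • I y + c • J y + d • K y = 0) : a = 0 ∧ b = 0 ∧ c = 0 ∧ d = 0 := by
  have hI := congrArg I H
  have hJ := congrArg J H
  have hK := congrArg K H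
  simp only [map_add, map_smul, map_zero, h.sq₁, h.sq₂, h.sq₃, h.mul₁₂, h.mul₂₁, h.mul₂₃, h.mul₃₂,
    h.mul₃₁, h.mul₁₃] at hI hJ hK
  -- The combination is `q y` for the quaternion `q = a + b i + c j + d k`; apply its conjugate.
  have key : (a ^ 2 + b ^ 2 + c ^ 2 + d ^ 2) • y = 0 := by
    linear_combination (norm := module) a • H - b • hI - c • hJ - d • hK
  have := (smul_eq_zero.1 key).resolve_right hy
  refine ⟨?_, ?_, ?_, ?_⟩ <;> nlinarith [sq_nonneg a, sq_nonneg b, sq_nonneg c, sq_nonneg d]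

end IsQuaternionTriple

/-- The trace of a continuous endomorphism. -/
def tr (A : V →L[ℝ] V) : ℝ := LinearMap.trace ℝ V (A : V →ₗ[ℝ] V)

@[simp] theorem tr_add (A B : V →L[ℝ] V) : tr (A + B) = tr A + tr B := by simp [tr]
@[simp] theorem tr_sub (A B : V →L[ℝ] V) : tr (A - B) = tr A - tr B := by simp [tr]
@[simp] theorem tr_smul (c : ℝ) (A : V →L[ℝ] V) : tr (c • A) = c * tr A := by simp [tr]
@[simp] theorem tr_neg (A : V →L[ℝ] V) : tr (-A) = -tr A := by simp [tr]

theorem tr_comp_comm (A B : V →L[ℝ] V) : tr (A ∘L B) = tr (B ∘L A) :=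
  LinearMap.trace_mul_comm ℝ (A : V →ₗ[ℝ] V) (B : V →ₗ[ℝ] V)

theorem tr_id [FiniteDimensional ℝ V] :
    tr (ContinuousLinearMap.id ℝ V) = Module.finrank ℝ V := by
  simp [tr]

theorem tr_smulRight [FiniteDimensional ℝ V] (f : V →L[ℝ] ℝ) (v : V) :
    tr (f.smulRight v) = f v := by
  have : ((f.smulRight v : V →L[ℝ] V) : V →ₗ[ℝ] V) = (f : V →ₗ[ℝ] ℝ).smulRight v := by
    ext; simp
  rw [tr, this]
  simp

namespace IsQuaternionTriple

variable {I J K : V →L[ℝ] V}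

theorem tr_eq_zero (h : IsQuaternionTriple I J K) : tr I = 0 ∧ tr J = 0 ∧ tr K = 0 := by
  have aux : ∀ {I J K : V →L[ℝ] V}, IsQuaternionTriple I J K → tr K = 0 := by
    intro I J K h
    have h1 : I ∘L J = K := by ext z; exact h.mul₁₂ z
    have h2 : J ∘L I = -K := by ext z; exact h.mul₂₁ z
    have h3 := tr_comp_comm I J
    rw [h1, h2, tr_neg] at h3
    linarith
  exact ⟨aux h.rotate, aux h.rotate.rotate, aux h⟩

variable [FiniteDimensional ℝ V]

theorem tr_comp (h : IsQuaternionTriple I J K) :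
    tr (I ∘L I) = -Module.finrank ℝ V ∧ tr (J ∘L I) = 0 ∧ tr (K ∘L I) = 0 := by
  obtain ⟨-, hJ, hK⟩ := h.tr_eq_zero
  have h1 : I ∘L I = -ContinuousLinearMap.id ℝ V := by ext z; exact h.sq₁ z
  have h2 : J ∘L I = -K := by ext z; exact h.mul₂₁ z
  have h3 : K ∘L I = J := by ext z; exact h.mul₃₁ z
  simp [h1, h2, h3, hJ, hK, tr_id]

end IsQuaternionTriple

variable [FiniteDimensional ℝ V] [T2Space V]

/-- For a one-form `ξ` and an admissible triple `(I, J, K)`, the symmetric tensor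
`S_Y Z = ξ(Y) Z + ξ(Z) Y - ∑_{L = I, J, K} (ξ(L Y) L Z + ξ(L Z) L Y)`. -/
def correction (ξ : V →L[ℝ] ℝ) (I J K : V →L[ℝ] V) : V →L[ℝ] V →L[ℝ] V :=
  LinearMap.toContinuousBilinearMap <| LinearMap.mk₂ ℝ
    (fun y z ↦ ξ y • z + ξ z • y - (ξ (I y) • I z + ξ (I z) • I y)
      - (ξ (J y) • J z + ξ (J z) • J y) - (ξ (K y) • K z + ξ (K z) • K y))
    (by intros; simp only [map_add]; module) (by intros; simp only [map_smul, smul_eq_mul]; module)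
    (by intros; simp only [map_add]; module) (by intros; simp only [map_smul, smul_eq_mul]; module)

theorem correction_apply (ξ : V →L[ℝ] ℝ) (I J K : V →L[ℝ] V) (y z : V) :
    correction ξ I J K y z = ξ y • z + ξ z • y - (ξ (I y) • I z + ξ (I z) • I y)
      - (ξ (J y) • J z + ξ (J z) • J y) - (ξ (K y) • K z + ξ (K z) • K y) := by
  simp [correction]

theorem correction_comm (ξ : V →L[ℝ] ℝ) (I J K : V →L[ℝ] V) (y z : V) :
    correction ξ I J K y z = correction ξ I J K z y := by
  simp only [correction_apply]; module

theorem correction_rotate (ξ : V →L[ℝ] ℝ) (I J K : V →L[ℝ] V) :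
    correction ξ J K I = correction ξ I J K := by
  ext y z
  simp only [correction_apply]; module

namespace IsQuaternionTriple

variable {I J K : V →L[ℝ] V}

/-- `[S_y, I] = 2 ξ(J y) K - 2 ξ(K y) J`; the commutators with `J` and `K` follow by rotating the
triple. -/
theorem correction_commutator (h : IsQuaternionTriple I J K) (ξ : V →L[ℝ] ℝ) (y z : V) :
    correction ξ I J K y (I z) - I (correction ξ I J K y z) =
      (2 * ξ (J y)) • K z - (2 * ξ (K y)) • J z := by
  simp only [correction_apply, map_add, map_sub, map_smul, h.sq₁, h.mul₁₂, h.mul₂₁, h.mul₃₁,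
    h.mul₁₃, map_neg]
  module

theorem correction_commutator_mem (h : IsQuaternionTriple I J K) (ξ : V →L[ℝ] ℝ) (y : V)
    {A : V →L[ℝ] V} (hA : A ∈ Submodule.span ℝ {I, J, K}) :
    correction ξ I J K y ∘L A - A ∘L correction ξ I J K y ∈ Submodule.span ℝ {I, J, K} := by
  have aux : ∀ {I J K : V →L[ℝ] V}, IsQuaternionTriple I J K →
      correction ξ I J K y ∘L I - I ∘L correction ξ I J K y ∈ Submodule.span ℝ {I, J, K} := by
    intro I J K h
    have : correction ξ I J K y ∘L I - I ∘L correction ξ I J K y =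
        (2 * ξ (J y)) • K - (2 * ξ (K y)) • J := by
      ext z; exact h.correction_commutator ξ y z
    rw [this]
    refine sub_mem (Submodule.smul_mem _ _ (Submodule.subset_span ?_))
      (Submodule.smul_mem _ _ (Submodule.subset_span ?_)) <;> simp
  have hrot : ∀ {I J K : V →L[ℝ] V}, ({J, K, I} : Set (V →L[ℝ] V)) = {I, J, K} := by
    intro I J K; ext; simp; tauto
  induction hA using Submodule.span_induction with
  | mem A hA =>
    obtain rfl | rfl | rfl := hA
    · exact aux h
    · rw [← hrot, ← correction_rotate]
      exact aux h.rotate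
    · rw [← hrot, ← hrot, ← correction_rotate, ← correction_rotate]
      exact aux h.rotate.rotate
  | zero => simp
  | add A B _ _ hA hB =>
    convert add_mem hA hB using 1
    simp only [ContinuousLinearMap.comp_add, ContinuousLinearMap.add_comp]; abel
  | smul c A _ hA =>
    convert Submodule.smul_mem _ c hA using 1
    simp only [ContinuousLinearMap.comp_smul, ContinuousLinearMap.smul_comp, smul_sub]

theorem tr_correction (h : IsQuaternionTriple I J K) (ξ : V →L[ℝ] ℝ) (y : V) :
    tr (correction ξ I J K y) = (Module.finrank ℝ V + 4) * ξ y := by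
  have h1 : correction ξ I J K y = ξ y • ContinuousLinearMap.id ℝ V + ξ.smulRight y
      - (ξ (I y) • I + (ξ ∘L I).smulRight (I y)) - (ξ (J y) • J + (ξ ∘L J).smulRight (J y))
      - (ξ (K y) • K + (ξ ∘L K).smulRight (K y)) := by
    ext z; simp [correction_apply]
  obtain ⟨hI, hJ, hK⟩ := h.tr_eq_zero
  rw [h1]
  simp only [tr_sub, tr_add, tr_smul, tr_smulRight, tr_id, hI, hJ, hK,
    ContinuousLinearMap.comp_apply, h.sq₁, h.sq₂, h.sq₃, map_neg]
  ring

/-- If `[T, I]` lies in the span of `I, J, K`, its coefficients are traces of `T` against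
`J` and `K`. -/
theorem commutator_eq (h : IsQuaternionTriple I J K) [Nontrivial V] {T : V →L[ℝ] V}
    (hT : T ∘L I - I ∘L T ∈ Submodule.span ℝ {I, J, K}) (z : V) :
    T (I z) - I (T z) = (2 * (tr (T ∘L J) / Module.finrank ℝ V)) • K z
      - (2 * (tr (T ∘L K) / Module.finrank ℝ V)) • J z := by
  have hm : (Module.finrank ℝ V : ℝ) ≠ 0 := by exact_mod_cast Module.finrank_pos.ne'
  obtain ⟨p, q, r, hpqr⟩ := Submodule.mem_span_triple.1 hT
  -- `tr ([T, I] L) = tr (T [I, L])` for `L = I, J, K`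
  have key : ∀ L : V →L[ℝ] V, tr ((T ∘L I - I ∘L T) ∘L L) = tr (T ∘L (I ∘L L - L ∘L I)) := by
    intro L
    have : tr (I ∘L (T ∘L L)) = tr ((T ∘L L) ∘L I) := tr_comp_comm _ _
    rw [ContinuousLinearMap.sub_comp, ContinuousLinearMap.comp_sub, tr_sub, tr_sub]
    rw [ContinuousLinearMap.comp_assoc, ContinuousLinearMap.comp_assoc, this,
      ContinuousLinearMap.comp_assoc]
  have e1 : I ∘L I - I ∘L I = 0 := sub_self _
  have e2 : I ∘L J - J ∘L I = (2 : ℝ) • K := by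
    ext z; simp [h.mul₁₂, h.mul₂₁, two_smul]
  have e3 : I ∘L K - K ∘L I = (-2 : ℝ) • J := by
    ext z; simp [h.mul₁₃, h.mul₃₁, two_smul]; abel
  have k1 := key I
  have k2 := key J
  have k3 := key K
  rw [e1] at k1; rw [e2] at k2; rw [e3] at k3
  obtain ⟨a1, a2, a3⟩ := h.tr_comp
  obtain ⟨b1, b2, b3⟩ := h.rotate.tr_comp
  obtain ⟨c1, c2, c3⟩ := h.rotate.rotate.tr_comp
  have z0 : tr (0 : V →L[ℝ] V) = 0 := by simp [tr]
  simp only [← hpqr, ContinuousLinearMap.add_comp, ContinuousLinearMap.smul_comp, tr_add, tr_smul,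
    a1, a2, a3, b1, b2, b3, c1, c2, c3, ContinuousLinearMap.comp_smul,
    ContinuousLinearMap.comp_zero, z0] at k1 k2 k3
  have hp : p = 0 := by
    have : p * Module.finrank ℝ V = 0 := by linarith
    exact (mul_eq_zero.1 this).resolve_right hm
  have hq : q = -(2 * (tr (T ∘L K) / Module.finrank ℝ V)) := by
    field_simp; linarith
  have hr : r = 2 * (tr (T ∘L J) / Module.finrank ℝ V) := by
    field_simp; linarith
  have := congrArg (fun B : V →L[ℝ] V ↦ B z) hpqr
  simp only [hp, hq, hr] at this
  simp only [add_apply, smul_apply, sub_apply, ContinuousLinearMap.comp_apply, zero_smul] at this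
  rw [← this, zero_apply]; module

/-- If `T` is symmetric and `[T_y, I] = b(y) K - c(y) J`, then `b(y) = c(I y)`. -/
theorem coefficient_relation (h : IsQuaternionTriple I J K) {T : V → V → V}
    (hs : ∀ y z, T y z = T z y) {b c : V →ₗ[ℝ] ℝ}
    (hT : ∀ y z, T y (I z) - I (T y z) = b y • K z - c y • J z) (y : V) : b y = c (I y) := by
  by_cases hy : y = 0
  · simp [hy]
  -- Expand `T (I y) (I z)` in two ways, using the symmetry of `T`, for `z = J y`.
  have h1 : ∀ y z, T y (I z) = I (T y z) + (b y • K z - c y • J z) := fun y z ↦ by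
    rw [← hT]; abel
  have h2 : ∀ y z, T (I y) (I z) = I (I (T y z) + (b z • K y - c z • J y)) +
      (b (I y) • K z - c (I y) • J z) := by
    intro y z
    rw [h1, hs (I y) z, h1, hs z y]
  have h3 := h2 y (J y)
  rw [hs, h2 (J y) y, hs (J y) y] at h3
  simp only [map_add, map_sub, map_smul, h.sq₁, h.sq₂, h.mul₁₂, h.mul₁₃, h.mul₃₂,
    map_neg] at h3
  have h4 : (b y - c (I y)) • y + (b (I y) + c y) • I y + (b (J y) - c (K y)) • J y
      + (b (K y) + c (J y)) • K y = 0 := by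
    linear_combination (norm := module) h3
  have := (h.eq_zero_of_combination hy h4).1
  linarith

/-- A symmetric bilinear map which is complex linear in each argument for two anticommuting complex
structures vanishes. -/
theorem eq_zero_of_symmetric_linear (h : IsQuaternionTriple I J K) {C : V → V → V}
    (hs : ∀ y z, C y z = C z y) (hI : ∀ y z, C y (I z) = I (C y z))
    (hJ : ∀ y z, C y (J z) = J (C y z)) (y z : V) : C y z = 0 := by
  have h1 : C (I y) (J z) = -K (C y z) := by rw [hJ, hs, hI, hs, h.mul₂₁]
  have h2 : C (I y) (J z) = K (C y z) := by rw [hs, hI, hs, hJ, h.mul₁₂]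
  have h3 : K (C y z) = 0 := by
    have : (2 : ℝ) • K (C y z) = 0 := by
      linear_combination (norm := module) h1 - h2
    exact (smul_eq_zero.1 this).resolve_left two_ne_zero
  rw [← neg_eq_zero, ← h.sq₃, h3, map_zero]

/-- The first prolongation of `gl(n, ℍ) ⊕ sp(1)`: a symmetric bilinear map `T` for which every `T_y`
normalizes the span of `I, J, K` is a `correction`. -/
theorem eq_correction (h : IsQuaternionTriple I J K) [Nontrivial V] (T : V →L[ℝ] V →L[ℝ] V)
    (hs : ∀ y z, T y z = T z y)
    (hT : ∀ y, ∀ A ∈ ({I, J, K} : Set (V →L[ℝ] V)),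
      T y ∘L A - A ∘L T y ∈ Submodule.span ℝ {I, J, K}) :
    ∃ ξ : V →L[ℝ] ℝ, T = correction ξ I J K := by
  have hrot : ∀ {I J K : V →L[ℝ] V}, ({J, K, I} : Set (V →L[ℝ] V)) = {I, J, K} := by
    intro I J K; ext; simp; tauto
  have h₂ := h.rotate
  have h₃ := h₂.rotate
  set m : ℝ := (Module.finrank ℝ V : ℝ) with hm
  let coef (L : V →L[ℝ] V) : V →ₗ[ℝ] ℝ :=
    { toFun := fun y ↦ 2 * (tr (T y ∘L L) / m)
      map_add' := fun y z ↦ by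
        rw [map_add, ContinuousLinearMap.add_comp, tr_add]; ring
      map_smul' := fun c y ↦ by
        rw [map_smul, ContinuousLinearMap.smul_comp, tr_smul]; simp; ring }
  have hTI : ∀ y z, T y (I z) - I (T y z) = coef J y • K z - coef K y • J z := fun y z ↦
    h.commutator_eq (hT y I (by simp)) z
  have hTJ : ∀ y z, T y (J z) - J (T y z) = coef K y • I z - coef I y • K z := fun y z ↦
    h₂.commutator_eq (by rw [hrot]; exact hT y J (by simp)) z
  have hTK : ∀ y z, T y (K z) - K (T y z) = coef I y • J z - coef J y • I z := fun y z ↦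
    h₃.commutator_eq (by rw [hrot, hrot]; exact hT y K (by simp)) z
  have r₁ := h.coefficient_relation hs hTI
  have r₂ := h₂.coefficient_relation hs hTJ
  have r₃ := h₃.coefficient_relation hs hTK
  let ξ : V →L[ℝ] ℝ := LinearMap.toContinuousLinearMap (-(1 / 2 : ℝ) • (coef I ∘ₗ (I : V →ₗ[ℝ] V)))
  have hξ : ∀ y, ξ y = -(1 / 2) * coef I (I y) := fun y ↦ by simp [ξ]
  have ξJ : ∀ y, 2 * ξ (J y) = coef J y := fun y ↦ by
    rw [hξ, h.mul₁₂, r₃, h.sq₃, map_neg]; ring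
  have ξK : ∀ y, 2 * ξ (K y) = coef K y := fun y ↦ by
    rw [hξ, h.mul₁₃, map_neg, r₂]; ring
  have ξI : ∀ y, 2 * ξ (I y) = coef I y := fun y ↦ by
    rw [hξ, h.sq₁, map_neg]; ring
  refine ⟨ξ, ?_⟩
  -- The difference is quaternionic linear in each argument.
  have hC := h.eq_zero_of_symmetric_linear (C := fun y z ↦ T y z - correction ξ I J K y z)
    (fun y z ↦ by rw [hs, correction_comm])
    (fun y z ↦ by
      have h1 := hTI y z
      have h2 := h.correction_commutator ξ y z
      rw [ξJ, ξK, ← h1] at h2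
      rw [map_sub]
      linear_combination (norm := module) -h2)
    (fun y z ↦ by
      have h1 := hTJ y z
      have h2 := h₂.correction_commutator ξ y z
      rw [ξK, ξI, ← h1, correction_rotate] at h2
      rw [map_sub]
      linear_combination (norm := module) -h2)
  ext y z
  exact sub_eq_zero.1 (hC y z)

/-- The symmetric square `∑_{L = I, J, K} L ⊗ L` of an admissible basis in terms of an arbitrary
basis `A` of the span of `I, J, K`: the coefficients are those of the inverse of the Gram matrix for
the inner product `-tr(A B) / dim V`, for which `I, J, K` is an orthonormal basis. -/
theorem exists_gram_inverse (h : IsQuaternionTriple I J K) [Nontrivial V] {A : Fin 3 → V →L[ℝ] V}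
    (hA : Submodule.span ℝ (range A) = Submodule.span ℝ {I, J, K}) :
    let G : Matrix (Fin 3) (Fin 3) ℝ :=
      Matrix.of fun i j ↦ -(tr (A i ∘L A j) / Module.finrank ℝ V)
    G.det ≠ 0 ∧ ∀ (f : V →L[ℝ] ℝ) (y z : V), f (I y) • I z + f (J y) • J z + f (K y) • K z =
      ∑ i, ∑ j, (G⁻¹ i j * f (A i y)) • A j z := by
  intro G
  have hm : (Module.finrank ℝ V : ℝ) ≠ 0 := by exact_mod_cast Module.finrank_pos.ne'
  let e : Fin 3 → V →L[ℝ] V := ![I, J, K]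
  have he : range e = {I, J, K} := by
    ext B; simp [e, eq_comm]; tauto
  let g (B : V →L[ℝ] V) : (V →L[ℝ] V) →ₗ[ℝ] ℝ :=
    { toFun := fun A ↦ -(tr (A ∘L B) / Module.finrank ℝ V)
      map_add' := fun A A' ↦ by rw [ContinuousLinearMap.add_comp, tr_add]; ring
      map_smul' := fun c A ↦ by
        rw [ContinuousLinearMap.smul_comp, tr_smul, RingHom.id_apply, smul_eq_mul]; ring }
  have g_apply : ∀ A B, g B A = -(tr (A ∘L B) / Module.finrank ℝ V) := fun _ _ ↦ rfl
  have g_comm : ∀ A B, g B A = g A B := fun A B ↦ by rw [g_apply, g_apply, tr_comp_comm]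
  have gram : ∀ k l, g (e l) (e k) = (1 : Matrix (Fin 3) (Fin 3) ℝ) k l := by
    obtain ⟨a1, a2, a3⟩ := h.tr_comp
    obtain ⟨b1, b2, b3⟩ := h.rotate.tr_comp
    obtain ⟨c1, c2, c3⟩ := h.rotate.rotate.tr_comp
    intro k l
    rw [g_apply]
    fin_cases k <;> fin_cases l <;> simp [e, a1, a2, a3, b1, b2, b3, c1, c2, c3] <;> field_simp
  have hP : ∀ i, ∃ p : Fin 3 → ℝ, ∑ k, p k • e k = A i := fun i ↦
    (Submodule.mem_span_range_iff_exists_fun ℝ).1 (by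
      rw [he, ← hA]; exact Submodule.subset_span ⟨i, rfl⟩)
  have hR : ∀ k, ∃ r : Fin 3 → ℝ, ∑ i, r i • A i = e k := fun k ↦
    (Submodule.mem_span_range_iff_exists_fun ℝ).1 (by
      rw [hA, ← he]; exact Submodule.subset_span ⟨k, rfl⟩)
  choose P hP using hP
  choose R hR using hR
  have hgP : ∀ i l, g (e l) (A i) = P i l := fun i l ↦ by
    rw [← hP i, map_sum]
    simp [gram, Matrix.one_apply]
  have hG : G = Matrix.of P * (Matrix.of P).transpose := by
    ext i j
    have : G i j = g (A j) (A i) := rfl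
    rw [this, ← hP i, map_sum]
    simp only [map_smul, g_comm (e _), hgP, Matrix.mul_apply, Matrix.transpose_apply,
      Matrix.of_apply, smul_eq_mul]
  have hRP : Matrix.of R * Matrix.of P = 1 := by
    ext k l
    rw [← gram, ← hR k, map_sum]
    simp [Matrix.mul_apply, hgP]
  have hPu : IsUnit (Matrix.of P).det := by
    have := congrArg Matrix.det hRP
    rw [Matrix.det_mul, Matrix.det_one] at this
    exact IsUnit.of_mul_eq_one _ (by rw [mul_comm]; exact this)
  have hPG : (Matrix.of P).transpose * G⁻¹ * Matrix.of P = 1 := by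
    rw [hG, Matrix.mul_inv_rev, ← Matrix.mul_assoc,
      Matrix.mul_nonsing_inv _ (by rwa [Matrix.det_transpose]), Matrix.one_mul,
      Matrix.nonsing_inv_mul _ hPu]
  refine ⟨?_, fun f y z ↦ ?_⟩
  · rw [hG, Matrix.det_mul, Matrix.det_transpose]
    exact mul_ne_zero hPu.ne_zero hPu.ne_zero
  have hAz : ∀ i z, A i z = ∑ k, P i k • e k z := fun i z ↦ by
    rw [← hP i]; simp
  have hPG' : ∀ k l, ∑ j, (∑ i, P i k * G⁻¹ i j) * P j l = (1 : Matrix (Fin 3) (Fin 3) ℝ) k l := by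
    intro k l
    rw [← hPG]
    simp [Matrix.mul_apply]
  have reorder : ∀ F : Fin 3 → Fin 3 → Fin 3 → Fin 3 → V,
      ∑ k, ∑ l, ∑ j, ∑ i, F k l j i = ∑ i, ∑ j, ∑ k, ∑ l, F k l j i := by
    intro F
    calc _ = ∑ k, ∑ j, ∑ i, ∑ l, F k l j i := by
          refine Finset.sum_congr rfl fun k _ ↦ ?_
          rw [Finset.sum_comm]
          exact Finset.sum_congr rfl fun j _ ↦ Finset.sum_comm
      _ = ∑ j, ∑ i, ∑ k, ∑ l, F k l j i := by
          rw [Finset.sum_comm]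
          exact Finset.sum_congr rfl fun j _ ↦ Finset.sum_comm
      _ = _ := Finset.sum_comm
  calc f (I y) • I z + f (J y) • J z + f (K y) • K z
      = ∑ k, ∑ l, ((1 : Matrix (Fin 3) (Fin 3) ℝ) k l * f (e k y)) • e l z := by
        simp [Fin.sum_univ_three, e, Matrix.one_apply]
    _ = ∑ k, ∑ l, ∑ j, ∑ i, (P i k * G⁻¹ i j * P j l * f (e k y)) • e l z := by
        refine Finset.sum_congr rfl fun k _ ↦ Finset.sum_congr rfl fun l _ ↦ ?_
        rw [← hPG', Finset.sum_mul, Finset.sum_smul]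
        refine Finset.sum_congr rfl fun j _ ↦ ?_
        rw [Finset.sum_mul, Finset.sum_mul, Finset.sum_smul]
    _ = ∑ i, ∑ j, ∑ k, ∑ l, (P i k * G⁻¹ i j * P j l * f (e k y)) • e l z := by
        exact reorder fun k l j i ↦ (P i k * G⁻¹ i j * P j l * f (e k y)) • e l z
    _ = ∑ i, ∑ j, (G⁻¹ i j * f (A i y)) • A j z := by
        refine Finset.sum_congr rfl fun i _ ↦ Finset.sum_congr rfl fun j _ ↦ ?_
        rw [hAz i y, hAz j z, map_sum, Finset.mul_sum, Finset.sum_smul]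
        refine Finset.sum_congr rfl fun k _ ↦ ?_
        rw [Finset.smul_sum]
        refine Finset.sum_congr rfl fun l _ ↦ ?_
        rw [map_smul, smul_smul, smul_eq_mul]
        congr 1; ring

end IsQuaternionTriple
end LinearAlgebra

end

/-! ### Smooth vector fields and sections of the endomorphism bundle -/

section

variable {E : Type*} [NormedAddCommGroup E] [NormedSpace ℝ E] [FiniteDimensional ℝ E]
  {M : Type*} [TopologicalSpace M] [ChartedSpace E M] [IsManifold 𝓘(ℝ, E) ∞ M]

instance (x : M) : FiniteDimensional ℝ (TangentSpace 𝓘(ℝ, E) x) :=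
  inferInstanceAs (FiniteDimensional ℝ E)

instance (x : M) : T2Space (TangentSpace 𝓘(ℝ, E) x) :=
  inferInstanceAs (T2Space E)

section GlobalSections

variable [T2Space M]

/-- A smooth local section of a vector bundle becomes a smooth global one after multiplication with
a suitable smooth function that equals `1` near the given point. -/
theorem exists_smooth_cutoff {F : Type*} [NormedAddCommGroup F] [NormedSpace ℝ F] {V : M → Type*}
    [TopologicalSpace (TotalSpace F V)] [∀ x, TopologicalSpace (V x)] [FiberBundle F V]
    [∀ x, AddCommGroup (V x)] [∀ x, Module ℝ (V x)] [VectorBundle ℝ F V]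
    {s : Π x, V x} {U : Set M} {x₀ : M} (hU : IsOpen U) (hx : x₀ ∈ U)
    (hs : ContMDiffOn 𝓘(ℝ, E) (𝓘(ℝ, E).prod 𝓘(ℝ, F)) ∞ (fun x ↦ TotalSpace.mk' F x (s x)) U) :
    ∃ ψ : M → ℝ, (∀ x ∉ U, ψ x = 0) ∧ (∀ᶠ y in 𝓝 x₀, ψ y = 1) ∧
      ContMDiff 𝓘(ℝ, E) (𝓘(ℝ, E).prod 𝓘(ℝ, F)) ∞ (fun x ↦ TotalSpace.mk' F x (ψ x • s x)) := by
  obtain ⟨f, -, hf⟩ := (SmoothBumpFunction.nhds_basis_tsupport (I := 𝓘(ℝ, E)) x₀).mem_iff.1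
    (hU.mem_nhds hx)
  exact ⟨f, fun x hx ↦ image_eq_zero_of_notMem_tsupport fun h ↦ hx (hf h), f.eventuallyEq_one,
    ContMDiffOn.smul_section_of_tsupport f.contMDiff.contMDiffOn hU hf hs⟩

/-- Every tangent frame given by a trivialization is, near the given point, the restriction of
smooth global vector fields. -/
theorem exists_smooth_frame {ι : Type*} (b : ι → E) (x₀ : M) :
    ∃ e : ι → Π x : M, TangentSpace 𝓘(ℝ, E) x, (∀ i, SmoothVF (e i)) ∧ ∀ i, ∀ᶠ y in 𝓝 x₀,
      e i y = (trivializationAt E (TangentSpace 𝓘(ℝ, E)) x₀).symm y (b i) := by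
  set t := trivializationAt E (TangentSpace 𝓘(ℝ, E) : M → Type _) x₀ with ht
  have hx : x₀ ∈ t.baseSet := FiberBundle.mem_baseSet_trivializationAt E _ x₀
  have hsm : ∀ i, ContMDiffOn 𝓘(ℝ, E) (𝓘(ℝ, E).prod 𝓘(ℝ, E)) ∞
      (fun x ↦ TotalSpace.mk' E (E := fun x : M ↦ TangentSpace 𝓘(ℝ, E) x) x (t.symm x (b i)))
      t.baseSet := by
    intro i
    rw [t.contMDiffOn_section_baseSet_iff]
    refine (contMDiffOn_const (c := b i)).congr fun y hy ↦ ?_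
    simp [t.apply_mk_symm hy]
  have h := fun i ↦ exists_smooth_cutoff t.open_baseSet hx (hsm i)
  choose ψ _ hψ1 hψs using h
  refine ⟨fun i x ↦ ψ i x • t.symm x (b i), hψs, fun i ↦ ?_⟩
  filter_upwards [hψ1 i] with y hy
  rw [hy, one_smul]

theorem exists_smoothVF_eq (x₀ : M) (v : TangentSpace 𝓘(ℝ, E) x₀) :
    ∃ Y : Π x : M, TangentSpace 𝓘(ℝ, E) x, SmoothVF Y ∧ Y x₀ = v := by
  set t := trivializationAt E (TangentSpace 𝓘(ℝ, E) : M → Type _) x₀ with ht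
  have hx : x₀ ∈ t.baseSet := FiberBundle.mem_baseSet_trivializationAt E _ x₀
  obtain ⟨e, he, h⟩ := exists_smooth_frame (ι := Unit) (fun _ ↦ (t ⟨x₀, v⟩).2) x₀
  refine ⟨e (), he (), ?_⟩
  rw [(h ()).self_of_nhds]
  exact t.symm_apply_apply_mk hx v

end GlobalSections

theorem SmoothVF.mdifferentiableAt {Y : Π x : M, TangentSpace 𝓘(ℝ, E) x} (hY : SmoothVF Y)
    (x : M) : MDiffAt (T% Y) x :=
  (hY x).mdifferentiableAt (by simp)

theorem SmoothEndOn.contMDiffAt {A : Π x : M, EndT E x} {U : Set M} (hA : SmoothEndOn A U)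
    (hU : IsOpen U) {x : M} (hx : x ∈ U) :
    ContMDiffAt 𝓘(ℝ, E) (𝓘(ℝ, E).prod 𝓘(ℝ, E →L[ℝ] E)) ∞
    (fun x ↦ TotalSpace.mk' (E →L[ℝ] E) (E := fun x : M ↦ EndT E x) x (A x)) x :=
  (hA x hx).contMDiffAt (hU.mem_nhds hx)

theorem SmoothEndOn.apply {A : Π x : M, EndT E x} (hA : SmoothEndOn A univ)
    {Y : Π x : M, TangentSpace 𝓘(ℝ, E) x} (hY : SmoothVF Y) : SmoothVF (fun x ↦ A x (Y x)) :=
  fun x ↦ (hA.contMDiffAt isOpen_univ (mem_univ x)).clm_bundle_apply (hY x)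

theorem SmoothVF.sub {Y Z : Π x : M, TangentSpace 𝓘(ℝ, E) x} (hY : SmoothVF Y) (hZ : SmoothVF Z) :
    SmoothVF (fun x ↦ Y x - Z x) :=
  ContMDiff.sub_section hY hZ

theorem SmoothVF.smul {f : M → ℝ} (hf : ContMDiff 𝓘(ℝ, E) 𝓘(ℝ, ℝ) ∞ f)
    {Y : Π x : M, TangentSpace 𝓘(ℝ, E) x} (hY : SmoothVF Y) :
    SmoothVF (fun x ↦ f x • Y x) :=
  ContMDiff.smul_section hf hY

theorem SmoothVF.mlieBracket {X Y : Π x : M, TangentSpace 𝓘(ℝ, E) x} (hX : SmoothVF X)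
    (hY : SmoothVF Y) : SmoothVF (fun x ↦ VectorField.mlieBracket 𝓘(ℝ, E) X Y x) := by
  intro x
  have : IsManifold 𝓘(ℝ, E) (minSmoothness ℝ 2) M := by
    rw [minSmoothness_of_isRCLikeNormedField]; infer_instance
  have : IsManifold 𝓘(ℝ, E) (((⊤ : ℕ∞) : ℕ∞ω) + 1) M := by simpa using ‹IsManifold 𝓘(ℝ, E) ∞ M›
  exact ContMDiffAt.mlieBracket_vectorField (m := ⊤) (n := ⊤) (hX x) (hY x) (by simp)

/-- A map to `E →L[ℝ] E` is smooth if its values on the vectors of a basis are. -/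
theorem contMDiffAt_clm_of_basis {ι : Type*} [Fintype ι] (b : Module.Basis ι ℝ E)
    {f : M → E →L[ℝ] E} {x₀ : M} (h : ∀ i, ContMDiffAt 𝓘(ℝ, E) 𝓘(ℝ, E) ∞ (fun x ↦ f x (b i)) x₀) :
    ContMDiffAt 𝓘(ℝ, E) 𝓘(ℝ, E →L[ℝ] E) ∞ f x₀ := by
  have hf : f = fun x ↦ ∑ i, ContinuousLinearMap.smulRightL ℝ E E
      (LinearMap.toContinuousLinearMap (b.coord i)) (f x (b i)) := by
    funext x
    ext v
    conv_lhs => rw [← b.sum_repr v, map_sum]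
    simp
  rw [hf]
  refine ContMDiffAt.sum fun i _ ↦ ?_
  exact ((ContinuousLinearMap.smulRightL ℝ E E
    (LinearMap.toContinuousLinearMap (b.coord i))).contMDiff.contMDiffAt).comp x₀ (h i)

section Criteria

variable [T2Space M]

/-- A section of `End(TM)` is smooth if it maps smooth vector fields to smooth vector fields. -/
theorem smoothEndOn_univ_of_apply {A : Π x : M, EndT E x}
    (h : ∀ Y : Π x : M, TangentSpace 𝓘(ℝ, E) x, SmoothVF Y → SmoothVF (fun x ↦ A x (Y x))) :
    SmoothEndOn A univ := by
  intro x₀ _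
  refine ContMDiffAt.contMDiffWithinAt ?_
  rw [contMDiffAt_hom_bundle]
  refine ⟨contMDiffAt_id, ?_⟩
  set t := trivializationAt E (TangentSpace 𝓘(ℝ, E) : M → Type _) x₀ with ht
  have hx : x₀ ∈ t.baseSet := FiberBundle.mem_baseSet_trivializationAt E _ x₀
  let b := Module.finBasis ℝ E
  obtain ⟨e, he, hev⟩ := exists_smooth_frame b x₀
  refine contMDiffAt_clm_of_basis b fun i ↦ ?_
  refine ((contMDiffAt_section x₀).1 (h (e i) (he i) x₀)).congr_of_eventuallyEq ?_
  filter_upwards [hev i, t.open_baseSet.mem_nhds hx] with y hy hyt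
  rw [hy, ContinuousLinearMap.inCoordinates_eq hyt hyt]
  rfl

end Criteria

/-- The function `tr (A B)` is smooth for smooth sections `A`, `B` of `End(TM)`. -/
theorem contMDiffAt_tr_comp {A B : Π x : M, EndT E x} {x₀ : M}
    (hA : ContMDiffAt 𝓘(ℝ, E) (𝓘(ℝ, E).prod 𝓘(ℝ, E →L[ℝ] E)) ∞
      (fun x ↦ TotalSpace.mk' (E →L[ℝ] E) (E := fun x : M ↦ EndT E x) x (A x)) x₀)
    (hB : ContMDiffAt 𝓘(ℝ, E) (𝓘(ℝ, E).prod 𝓘(ℝ, E →L[ℝ] E)) ∞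
      (fun x ↦ TotalSpace.mk' (E →L[ℝ] E) (E := fun x : M ↦ EndT E x) x (B x)) x₀) :
    ContMDiffAt 𝓘(ℝ, E) 𝓘(ℝ, ℝ) ∞ (fun x ↦ tr (A x ∘L B x)) x₀ := by
  rw [contMDiffAt_hom_bundle] at hA hB
  set t := trivializationAt E (TangentSpace 𝓘(ℝ, E) : M → Type _) x₀ with ht
  have hx : x₀ ∈ t.baseSet := FiberBundle.mem_baseSet_trivializationAt E _ x₀
  let trL : (E →L[ℝ] E) →L[ℝ] ℝ := LinearMap.toContinuousLinearMap
    { toFun := tr, map_add' := tr_add, map_smul' := fun c A ↦ by simp }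
  refine (trL.contMDiff.contMDiffAt.comp x₀ (hA.2.clm_comp hB.2)).congr_of_eventuallyEq ?_
  filter_upwards [t.open_baseSet.mem_nhds hx] with y hyt
  have hconj : ∀ C : EndT E y, tr C = tr (((t.continuousLinearEquivAt ℝ y hyt :
      TangentSpace 𝓘(ℝ, E) y →L[ℝ] E) ∘L C ∘L
      ((t.continuousLinearEquivAt ℝ y hyt).symm : E →L[ℝ] TangentSpace 𝓘(ℝ, E) y) :
        E →L[ℝ] E)) := by
    intro C
    exact (LinearMap.trace_conj' (C : TangentSpace 𝓘(ℝ, E) y →ₗ[ℝ] TangentSpace 𝓘(ℝ, E) y)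
      (t.continuousLinearEquivAt ℝ y hyt).toLinearEquiv).symm
  simp only [Function.comp_apply]
  rw [ContinuousLinearMap.inCoordinates_eq hyt hyt, ContinuousLinearMap.inCoordinates_eq hyt hyt,
    hconj]
  change tr _ = tr _
  congr 1
  ext v
  exact congrArg (fun w ↦ t.continuousLinearEquivAt ℝ y hyt (A y w))
    ((t.continuousLinearEquivAt ℝ y hyt).symm_apply_apply _).symm

end

/-! ### Changing a quaternionic connection by a one-form -/

section

variable {E : Type*} [NormedAddCommGroup E] [NormedSpace ℝ E] [FiniteDimensional ℝ E]
  {M : Type*} [TopologicalSpace M] [ChartedSpace E M] [IsManifold 𝓘(ℝ, E) ∞ M]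
  {Q : Π x : M, Submodule ℝ (EndT E x)}

theorem contMDiffAt_det {n : ℕ} {G : M → Matrix (Fin n) (Fin n) ℝ} {x₀ : M}
    (hG : ∀ i j, ContMDiffAt 𝓘(ℝ, E) 𝓘(ℝ, ℝ) ∞ (fun x ↦ G x i j) x₀) :
    ContMDiffAt 𝓘(ℝ, E) 𝓘(ℝ, ℝ) ∞ (fun x ↦ (G x).det) x₀ := by
  simp only [Matrix.det_apply']
  exact ContMDiffAt.sum fun σ _ ↦ contMDiffAt_const.mul
    (contMDiffAt_finsetProd fun i _ ↦ hG _ _)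

theorem contMDiffAt_inv_apply {n : ℕ} {G : M → Matrix (Fin n) (Fin n) ℝ} {x₀ : M}
    (hG : ∀ i j, ContMDiffAt 𝓘(ℝ, E) 𝓘(ℝ, ℝ) ∞ (fun x ↦ G x i j) x₀) (h0 : (G x₀).det ≠ 0)
    (i j : Fin n) : ContMDiffAt 𝓘(ℝ, E) 𝓘(ℝ, ℝ) ∞ (fun x ↦ (G x)⁻¹ i j) x₀ := by
  simp only [Matrix.inv_def, Ring.inverse_eq_inv', Matrix.smul_apply, smul_eq_mul,
    Matrix.adjugate_apply]
  refine ((contMDiffAt_det hG).inv₀ h0).mul (contMDiffAt_det fun k l ↦ ?_)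
  by_cases hk : k = j
  · subst hk; simpa using contMDiffAt_const
  · simpa [Matrix.updateRow_ne hk] using hG k l

namespace IsAlmostQuaternionic

theorem exists_triple (hQ : IsAlmostQuaternionic Q) (x : M) :
    ∃ T : EndT E x × EndT E x × EndT E x, IsQuaternionTriple T.1 T.2.1 T.2.2 ∧
      Q x = Submodule.span ℝ {T.1, T.2.1, T.2.2} := by
  obtain ⟨I, J, K, h1, h2, h3, h4, h5, h6⟩ := hQ.admissible x
  exact ⟨(I, J, K), ⟨fun z ↦ congrArg (fun A : EndT E x ↦ A z) h1,
    fun z ↦ congrArg (fun A : EndT E x ↦ A z) h2, fun z ↦ congrArg (fun A : EndT E x ↦ A z) h3,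
    fun z ↦ congrArg (fun A : EndT E x ↦ A z) h4,
    fun z ↦ congrArg (fun A : EndT E x ↦ A z) h5⟩, h6⟩

/-- The rank of `Q` excludes a zero-dimensional `M`, unless `M` is empty. -/
theorem nontrivial (hQ : IsAlmostQuaternionic Q) (x : M) :
    Nontrivial (TangentSpace 𝓘(ℝ, E) x) := by
  by_contra h
  rw [not_nontrivial_iff_subsingleton] at h
  have : Subsingleton (EndT E x) := ⟨fun A B ↦ by ext z; exact Subsingleton.elim _ _⟩
  have := hQ.rank_eq x
  rw [Module.finrank_zero_of_subsingleton] at this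
  omega

/-- Near every point, `Q` is spanned by three smooth global sections of `Q`. -/
theorem exists_global_frame [T2Space M] (hQ : IsAlmostQuaternionic Q) (x₀ : M) :
    ∃ A : Fin 3 → Π x : M, EndT E x, (∀ i, SmoothEndOn (A i) univ) ∧ (∀ i x, A i x ∈ Q x) ∧
      ∀ᶠ x in 𝓝 x₀, Q x = Submodule.span ℝ (range fun i ↦ A i x) := by
  obtain ⟨U, hU, hx, A, hA, hspan⟩ := hQ.smooth x₀
  have h := fun i ↦ exists_smooth_cutoff hU hx (hA i)
  choose ψ hψ0 hψ1 hψs using h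
  refine ⟨fun i x ↦ ψ i x • A i x, fun i ↦ (hψs i).contMDiffOn, fun i x ↦ ?_, ?_⟩
  · change ψ i x • A i x ∈ Q x
    by_cases hxU : x ∈ U
    · rw [hspan x hxU]
      exact Submodule.smul_mem _ _ (Submodule.subset_span ⟨i, rfl⟩)
    · rw [hψ0 i x hxU, zero_smul]
      exact zero_mem _
  · filter_upwards [hU.mem_nhds hx, Filter.eventually_all.2 hψ1] with x hxU hx1
    simp only [hx1, one_smul, hspan x hxU]

/-- Every element of `Q` extends to a smooth global section of `Q`. -/
theorem exists_section_eq [T2Space M] (hQ : IsAlmostQuaternionic Q) {x₀ : M} {A₀ : EndT E x₀}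
    (hA₀ : A₀ ∈ Q x₀) :
    ∃ A : Π x : M, EndT E x, SmoothEndOn A univ ∧ (∀ x, A x ∈ Q x) ∧ A x₀ = A₀ := by
  obtain ⟨B, hB, hBQ, hspan⟩ := hQ.exists_global_frame x₀
  rw [hspan.self_of_nhds, Submodule.mem_span_range_iff_exists_fun] at hA₀
  obtain ⟨c, hc⟩ := hA₀
  refine ⟨fun x ↦ ∑ i, c i • B i x, smoothEndOn_univ_of_apply fun Y hY ↦ ?_,
    fun x ↦ sum_mem fun i _ ↦ Submodule.smul_mem _ _ (hBQ i x), hc⟩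
  simp only [sum_apply, smul_apply]
  exact ContMDiff.sum_section fun i _ ↦ contMDiff_const.smul_section ((hB i).apply hY)

/-- The tensor `S^ξ` of a one-form `ξ`: the difference of two quaternionic connections. The
admissible basis used at each point is a choice, on which the tensor does not depend. -/
def correction (hQ : IsAlmostQuaternionic Q) (ξ : Π x : M, TangentSpace 𝓘(ℝ, E) x →L[ℝ] ℝ)
    (x : M) : TangentSpace 𝓘(ℝ, E) x →L[ℝ] TangentSpace 𝓘(ℝ, E) x →L[ℝ] TangentSpace 𝓘(ℝ, E) x :=
  Quaternionic.correction (ξ x) (hQ.exists_triple x).choose.1 (hQ.exists_triple x).choose.2.1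
    (hQ.exists_triple x).choose.2.2

variable (hQ : IsAlmostQuaternionic Q) (ξ : Π x : M, TangentSpace 𝓘(ℝ, E) x →L[ℝ] ℝ)

theorem correction_symm (x : M) (y z : TangentSpace 𝓘(ℝ, E) x) :
    hQ.correction ξ x y z = hQ.correction ξ x z y :=
  Quaternionic.correction_comm _ _ _ _ _ _

theorem correction_commutator_mem {x : M} (y : TangentSpace 𝓘(ℝ, E) x) {A : EndT E x}
    (hA : A ∈ Q x) : hQ.correction ξ x y ∘L A - A ∘L hQ.correction ξ x y ∈ Q x := by
  obtain ⟨h1, h2⟩ := (hQ.exists_triple x).choose_spec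
  rw [h2] at hA ⊢
  exact h1.correction_commutator_mem _ _ hA

theorem tr_correction {x : M} (y : TangentSpace 𝓘(ℝ, E) x) :
    tr (hQ.correction ξ x y) = (Module.finrank ℝ E + 4) * ξ x y :=
  (hQ.exists_triple x).choose_spec.1.tr_correction _ _

/-- An admissible basis of `Q` need not be chosen smoothly: `∑_{L = I, J, K} L ⊗ L` is expressed by
a smooth local frame of `Q` and its Gram matrix. -/
theorem smooth_correction [T2Space M] (hξ : ∀ Y : Π x : M, TangentSpace 𝓘(ℝ, E) x, SmoothVF Y →
      ContMDiff 𝓘(ℝ, E) 𝓘(ℝ, ℝ) ∞ (fun x ↦ ξ x (Y x)))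
    {Y Z : Π x : M, TangentSpace 𝓘(ℝ, E) x} (hY : SmoothVF Y) (hZ : SmoothVF Z) :
    SmoothVF (fun x ↦ hQ.correction ξ x (Y x) (Z x)) := by
  intro x₀
  obtain ⟨A, hA, hAQ, hspan⟩ := hQ.exists_global_frame x₀
  let G : M → Matrix (Fin 3) (Fin 3) ℝ := fun x ↦
    Matrix.of fun i j ↦ -(tr (A i x ∘L A j x) / Module.finrank ℝ (TangentSpace 𝓘(ℝ, E) x))
  have key : ∀ᶠ x in 𝓝 x₀, (G x).det ≠ 0 ∧ ∀ y z : TangentSpace 𝓘(ℝ, E) x,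
      hQ.correction ξ x y z = ξ x y • z + ξ x z • y
        - ∑ i, ∑ j, ((G x)⁻¹ i j * ξ x (A i x y)) • A j x z
        - ∑ i, ∑ j, ((G x)⁻¹ i j * ξ x (A i x z)) • A j x y := by
    filter_upwards [hspan] with x hx
    obtain ⟨h1, h2⟩ := (hQ.exists_triple x).choose_spec
    have := hQ.nontrivial x
    obtain ⟨h3, h4⟩ := h1.exists_gram_inverse (A := fun i ↦ A i x) (hx.symm.trans h2)
    refine ⟨h3, fun y z ↦ ?_⟩
    rw [← h4 (ξ x) y z, ← h4 (ξ x) z y, correction, correction_apply]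
    module
  have hG : ∀ i j, ContMDiffAt 𝓘(ℝ, E) 𝓘(ℝ, ℝ) ∞ (fun x ↦ G x i j) x₀ := fun i j ↦
    ((contMDiffAt_tr_comp ((hA i).contMDiffAt isOpen_univ (mem_univ _))
      ((hA j).contMDiffAt isOpen_univ (mem_univ _))).div_const
        (Module.finrank ℝ E : ℝ)).neg
  have hGi := contMDiffAt_inv_apply hG key.self_of_nhds.1
  have hsum : ∀ {Y Z : Π x : M, TangentSpace 𝓘(ℝ, E) x}, SmoothVF Y → SmoothVF Z →
      ContMDiffAt 𝓘(ℝ, E) (𝓘(ℝ, E).prod 𝓘(ℝ, E)) ∞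
        (T% (fun x ↦ ∑ i, ∑ j, ((G x)⁻¹ i j * ξ x (A i x (Y x))) • A j x (Z x))) x₀ :=
    fun {Y Z} hY hZ ↦ ContMDiffAt.sum_section fun i _ ↦ ContMDiffAt.sum_section fun j _ ↦
      ((hGi i j).mul (hξ _ ((hA i).apply hY) x₀)).smul_section ((hA j).apply hZ x₀)
  have h1 := ((hξ Y hY).contMDiffAt (x := x₀)).smul_section (hZ x₀)
  have h2 := ((hξ Z hZ).contMDiffAt (x := x₀)).smul_section (hY x₀)
  refine (((h1.add_section h2).sub_section (hsum hY hZ)).sub_section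
    (hsum hZ hY)).congr_of_eventuallyEq ?_
  filter_upwards [key] with x hx
  rw [hx.2]
  rfl

end IsAlmostQuaternionic

/-- Adding the tensor `S^ξ` to a quaternionic connection gives a quaternionic connection. -/
theorem IsQuaternionicConnection.addOneForm_correction [T2Space M] {D : Connection E M}
    (hD : IsQuaternionicConnection Q D) (hQ : IsAlmostQuaternionic Q)
    (ξ : Π x : M, TangentSpace 𝓘(ℝ, E) x →L[ℝ] ℝ)
    (hξ : ∀ Y : Π x : M, TangentSpace 𝓘(ℝ, E) x, SmoothVF Y →
      ContMDiff 𝓘(ℝ, E) 𝓘(ℝ, ℝ) ∞ (fun x ↦ ξ x (Y x))) :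
    IsQuaternionicConnection Q (D.addOneForm (hQ.correction ξ)) where
  smooth := by
    refine ⟨⟨fun {σ} hσ ↦ ?_⟩⟩
    have hσ' : SmoothVF σ := by
      have := contMDiffOn_univ.1 hσ
      simpa using! this
    have h1 := hD.smooth.contMDiff.contMDiff hσ
    have h2 : SmoothEndOn (fun x ↦ hQ.correction ξ x (σ x)) univ :=
      smoothEndOn_univ_of_apply fun Y hY ↦ hQ.smooth_correction ξ hξ hσ' hY
    exact h1.add_section h2
  torsion_free := by
    refine (CovariantDerivative.torsion_eq_zero_iff _).2 fun {X Y x} hX hY ↦ ?_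
    rw [← (CovariantDerivative.torsion_eq_zero_iff D).1 hD.torsion_free hX hY]
    change (D Y x + hQ.correction ξ x (Y x)) (X x) - (D X x + hQ.correction ξ x (X x)) (Y x) = _
    rw [add_apply, add_apply, hQ.correction_symm]
    abel
  preserves A hA hAQ x v := by
    have h1 := hD.preserves A hA hAQ x v
    have h2 := hQ.correction_commutator_mem ξ v (hAQ x)
    convert add_mem h1 h2 using 1
    ext w
    obtain ⟨W, hW, rfl⟩ := exists_smoothVF_eq x w
    rw [add_apply, endDeriv_apply _ _ _ (hW.mdifferentiableAt x),
      endDeriv_apply _ _ _ (hW.mdifferentiableAt x)]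
    change (D (fun y ↦ A y (W y)) x + hQ.correction ξ x (A x (W x))) v -
      A x ((D W x + hQ.correction ξ x (W x)) v) = _
    simp only [add_apply, sub_apply, ContinuousLinearMap.comp_apply, map_add,
      hQ.correction_symm ξ x v]
    abel

end

/-! ### Vector fields in a chart -/

section

variable {E : Type*} [NormedAddCommGroup E] [NormedSpace ℝ E] [FiniteDimensional ℝ E]
  {M : Type*} [TopologicalSpace M] [ChartedSpace E M] [IsManifold 𝓘(ℝ, E) ∞ M]

theorem trivializationAt_self_apply (x₀ : M) (v : TangentSpace 𝓘(ℝ, E) x₀) :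
    (trivializationAt E (TangentSpace 𝓘(ℝ, E)) x₀ ⟨x₀, v⟩).2 = v :=
  (tangentBundleCore 𝓘(ℝ, E) M).coordChange_self (achart E x₀) x₀ (mem_achart_source E x₀) v

theorem trivializationAt_apply_eq_mfderiv {x₀ y : M} (hy : y ∈ (chartAt E x₀).source)
    (v : TangentSpace 𝓘(ℝ, E) y) :
    (trivializationAt E (TangentSpace 𝓘(ℝ, E)) x₀ ⟨y, v⟩).2 =
      mfderiv 𝓘(ℝ, E) 𝓘(ℝ, E) (extChartAt 𝓘(ℝ, E) x₀) y v := by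
  have hyt : y ∈ (trivializationAt E (TangentSpace 𝓘(ℝ, E) : M → Type _) x₀).baseSet := by
    simpa using hy
  have h := TangentBundle.continuousLinearMapAt_trivializationAt (I := 𝓘(ℝ, E)) hy
  refine Eq.trans ?_ (congrArg (fun A : TangentSpace 𝓘(ℝ, E) y →L[ℝ] E ↦ A v) h)
  exact (congrFun (Trivialization.coe_linearMapAt_of_mem (R := ℝ) _ hyt) v).symm

/-- The vector field `Y`, read in the preferred chart at `x₀`. Its values outside of
the target of the chart are meaningless; only its germ at the image of `x₀` is used. -/
def chartVF (x₀ : M) (Y : Π x : M, TangentSpace 𝓘(ℝ, E) x) (u : E) : E :=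
  (trivializationAt E (TangentSpace 𝓘(ℝ, E)) x₀
    ⟨(extChartAt 𝓘(ℝ, E) x₀).symm u, Y ((extChartAt 𝓘(ℝ, E) x₀).symm u)⟩).2

theorem chartVF_self (x₀ : M) (Y : Π x : M, TangentSpace 𝓘(ℝ, E) x) :
    chartVF x₀ Y (extChartAt 𝓘(ℝ, E) x₀ x₀) = Y x₀ := by
  rw [chartVF, extChartAt_to_inv]
  exact trivializationAt_self_apply x₀ (Y x₀)

theorem mfderiv_extChartAt_self (x₀ : M) (v : TangentSpace 𝓘(ℝ, E) x₀) :
    mfderiv 𝓘(ℝ, E) 𝓘(ℝ, E) (extChartAt 𝓘(ℝ, E) x₀) x₀ v = v := by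
  rw [← trivializationAt_apply_eq_mfderiv (mem_chart_source E x₀)]
  exact trivializationAt_self_apply x₀ v

theorem mpullbackWithin_eq_chartVF (x₀ : M) (Y : Π x : M, TangentSpace 𝓘(ℝ, E) x) {u : E}
    (hu : u ∈ (extChartAt 𝓘(ℝ, E) x₀).target) :
    mpullbackWithin 𝓘(ℝ, E) 𝓘(ℝ, E) (extChartAt 𝓘(ℝ, E) x₀).symm Y (range 𝓘(ℝ, E)) u =
      chartVF x₀ Y u := by
  set y := (extChartAt 𝓘(ℝ, E) x₀).symm u with hy
  have hys : y ∈ (extChartAt 𝓘(ℝ, E) x₀).source := (extChartAt 𝓘(ℝ, E) x₀).map_target hu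
  rw [extChartAt_source] at hys
  have hu' : u = extChartAt 𝓘(ℝ, E) x₀ y := ((extChartAt 𝓘(ℝ, E) x₀).right_inv hu).symm
  set t := trivializationAt E (TangentSpace 𝓘(ℝ, E) : M → Type _) x₀ with ht
  have hyt : y ∈ t.baseSet := by simpa [ht] using hys
  have h := TangentBundle.symmL_trivializationAt (I := 𝓘(ℝ, E)) hys
  rw [← hu'] at h
  have h2 : (mfderivWithin 𝓘(ℝ, E) 𝓘(ℝ, E) (extChartAt 𝓘(ℝ, E) x₀).symm (range 𝓘(ℝ, E)) u :
      E →L[ℝ] TangentSpace 𝓘(ℝ, E) y) = ((t.continuousLinearEquivAt ℝ y hyt).symm :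
      E →L[ℝ] TangentSpace 𝓘(ℝ, E) y) :=
    h.symm.trans (by ext v; exact congrFun (t.symm_continuousLinearEquivAt_eq hyt).symm v)
  refine (congrArg (fun A : E →L[ℝ] TangentSpace 𝓘(ℝ, E) y ↦ A.inverse (Y y)) h2).trans ?_
  simp only [ContinuousLinearMap.inverse_equiv]
  rfl

/-- The Lie bracket in the preferred chart. -/
theorem mlieBracket_eq_chart (x₀ : M) (X Y : Π x : M, TangentSpace 𝓘(ℝ, E) x) :
    mlieBracket 𝓘(ℝ, E) X Y x₀ =
      fderiv ℝ (chartVF x₀ Y) (extChartAt 𝓘(ℝ, E) x₀ x₀) (X x₀) -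
        fderiv ℝ (chartVF x₀ X) (extChartAt 𝓘(ℝ, E) x₀ x₀) (Y x₀) := by
  have hev : ∀ Y : Π x : M, TangentSpace 𝓘(ℝ, E) x,
      mpullbackWithin 𝓘(ℝ, E) 𝓘(ℝ, E) (extChartAt 𝓘(ℝ, E) x₀).symm Y (range 𝓘(ℝ, E))
        =ᶠ[𝓝 (extChartAt 𝓘(ℝ, E) x₀ x₀)] chartVF x₀ Y := by
    intro Y
    filter_upwards [extChartAt_target_mem_nhds (I := 𝓘(ℝ, E)) x₀] with u hu
    exact mpullbackWithin_eq_chartVF x₀ Y hu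
  rw [← mlieBracketWithin_univ, mlieBracketWithin_apply]
  have h1 : mfderiv 𝓘(ℝ, E) 𝓘(ℝ, E) (extChartAt 𝓘(ℝ, E) x₀) x₀ =
      ContinuousLinearMap.id ℝ E := by
    ext v; exact mfderiv_extChartAt_self x₀ v
  have h3 : (extChartAt 𝓘(ℝ, E) x₀).symm ⁻¹' univ ∩ range 𝓘(ℝ, E) = univ := by simp
  have key : ∀ V W : E → E, V =ᶠ[𝓝 (extChartAt 𝓘(ℝ, E) x₀ x₀)] chartVF x₀ X →
      W =ᶠ[𝓝 (extChartAt 𝓘(ℝ, E) x₀ x₀)] chartVF x₀ Y →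
      (ContinuousLinearMap.id ℝ E).inverse (lieBracketWithin ℝ V W
        ((extChartAt 𝓘(ℝ, E) x₀).symm ⁻¹' univ ∩ range 𝓘(ℝ, E)) (extChartAt 𝓘(ℝ, E) x₀ x₀)) =
      fderiv ℝ (chartVF x₀ Y) (extChartAt 𝓘(ℝ, E) x₀ x₀) (X x₀) -
        fderiv ℝ (chartVF x₀ X) (extChartAt 𝓘(ℝ, E) x₀ x₀) (Y x₀) := by
    intro V W hV hW
    rw [h3, lieBracketWithin_univ, ContinuousLinearMap.inverse_id, ContinuousLinearMap.id_apply,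
      hV.lieBracket_vectorField_eq hW, lieBracket_eq]
    simp only [chartVF_self]
  refine Eq.trans ?_ (key _ _ (hev X) (hev Y))
  exact congrArg (fun A : E →L[ℝ] E ↦ A.inverse _) h1

end

section

variable {E : Type*} [NormedAddCommGroup E] [NormedSpace ℝ E] [FiniteDimensional ℝ E]
  {M : Type*} [TopologicalSpace M] [ChartedSpace E M] [IsManifold 𝓘(ℝ, E) ∞ M]

theorem contDiffAt_comp_extChartAt_symm {F : Type*} [NormedAddCommGroup F] [NormedSpace ℝ F]
    {f : M → F} {x₀ : M} (hf : ContMDiffAt 𝓘(ℝ, E) 𝓘(ℝ, F) ∞ f x₀) :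
    ContDiffAt ℝ ∞ (f ∘ (extChartAt 𝓘(ℝ, E) x₀).symm) (extChartAt 𝓘(ℝ, E) x₀ x₀) := by
  have h := (contMDiffAt_iff.1 hf).2
  rw [modelWithCornersSelf_coe, range_id, contDiffWithinAt_univ] at h
  exact h

theorem contDiffAt_chartVF {x₀ : M} {Y : Π x : M, TangentSpace 𝓘(ℝ, E) x} (hY : SmoothVF Y) :
    ContDiffAt ℝ ∞ (chartVF x₀ Y) (extChartAt 𝓘(ℝ, E) x₀ x₀) :=
  contDiffAt_comp_extChartAt_symm ((contMDiffAt_section x₀).1 (hY x₀))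

/-- The endomorphism field `A`, read in the preferred chart at `x₀`. -/
def chartEnd (x₀ : M) (A : Π x : M, EndT E x) (u : E) : E →L[ℝ] E :=
  ContinuousLinearMap.inCoordinates E (TangentSpace 𝓘(ℝ, E)) E (TangentSpace 𝓘(ℝ, E))
    x₀ ((extChartAt 𝓘(ℝ, E) x₀).symm u) x₀ ((extChartAt 𝓘(ℝ, E) x₀).symm u)
    (A ((extChartAt 𝓘(ℝ, E) x₀).symm u))

theorem contDiffAt_chartEnd {x₀ : M} {A : Π x : M, EndT E x} (hA : SmoothEndOn A univ) :
    ContDiffAt ℝ ∞ (chartEnd x₀ A) (extChartAt 𝓘(ℝ, E) x₀ x₀) :=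
  contDiffAt_comp_extChartAt_symm
    ((contMDiffAt_hom_bundle _).1 (hA.contMDiffAt isOpen_univ (mem_univ x₀))).2

theorem inCoordinates_apply_trivializationAt {x₀ y : M} (hy : y ∈ (chartAt E x₀).source)
    (A : EndT E y) (v : TangentSpace 𝓘(ℝ, E) y) :
    ContinuousLinearMap.inCoordinates E (TangentSpace 𝓘(ℝ, E)) E (TangentSpace 𝓘(ℝ, E))
      x₀ y x₀ y A (trivializationAt E (TangentSpace 𝓘(ℝ, E)) x₀ ⟨y, v⟩).2 =
      (trivializationAt E (TangentSpace 𝓘(ℝ, E)) x₀ ⟨y, A v⟩).2 := by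
  set t := trivializationAt E (TangentSpace 𝓘(ℝ, E) : M → Type _) x₀ with ht
  have hyt : y ∈ t.baseSet := by simpa [ht] using hy
  rw [ContinuousLinearMap.inCoordinates_eq hyt hyt]
  exact congrArg (fun w ↦ t.continuousLinearEquivAt ℝ y hyt (A w))
    ((t.continuousLinearEquivAt ℝ y hyt).symm_apply_apply v)

theorem chartVF_apply {x₀ : M} {u : E} (hu : u ∈ (extChartAt 𝓘(ℝ, E) x₀).target)
    (A : Π x : M, EndT E x) (Z : Π x : M, TangentSpace 𝓘(ℝ, E) x) :
    chartVF x₀ (fun x ↦ A x (Z x)) u = chartEnd x₀ A u (chartVF x₀ Z u) := by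
  refine (inCoordinates_apply_trivializationAt ?_ _ _).symm
  rw [← extChartAt_source 𝓘(ℝ, E)]
  exact (extChartAt 𝓘(ℝ, E) x₀).map_target hu

theorem chartEnd_self (x₀ : M) (A : Π x : M, EndT E x) :
    chartEnd x₀ A (extChartAt 𝓘(ℝ, E) x₀ x₀) = A x₀ := by
  ext v
  have h := inCoordinates_apply_trivializationAt (mem_chart_source E x₀) (A x₀) v
  rw [trivializationAt_self_apply x₀ (A x₀ v)] at h
  refine Eq.trans ?_ (h.trans rfl)
  rw [chartEnd, extChartAt_to_inv]
  exact (congrArg (ContinuousLinearMap.inCoordinates E (TangentSpace 𝓘(ℝ, E)) E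
    (TangentSpace 𝓘(ℝ, E)) x₀ x₀ x₀ x₀ (A x₀)) (trivializationAt_self_apply x₀ v)).symm

/-- The Lie derivative of the endomorphism field `A` along `X` at `x₀`, computed in the preferred
chart: `∂_X A + A ∘ dX - dX ∘ A`. -/
def chartLieDeriv (x₀ : M) (X : Π x : M, TangentSpace 𝓘(ℝ, E) x) (A : Π x : M, EndT E x) :
    E →L[ℝ] E :=
  let u₀ : E := extChartAt 𝓘(ℝ, E) x₀ x₀
  fderiv ℝ (chartEnd x₀ A) u₀ (chartVF x₀ X u₀) +
    chartEnd x₀ A u₀ ∘L fderiv ℝ (chartVF x₀ X) u₀ - fderiv ℝ (chartVF x₀ X) u₀ ∘L chartEnd x₀ A u₀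

/-- The operator `Z ↦ [X, A Z] - A [X, Z]` is tensorial in `Z`: in the chart, the derivatives of `Z`
cancel. -/
theorem lieDerivEnd_eq_chart {x₀ : M} (X : Π x : M, TangentSpace 𝓘(ℝ, E) x)
    {A : Π x : M, EndT E x} (hA : SmoothEndOn A univ) {Z : Π x : M, TangentSpace 𝓘(ℝ, E) x}
    (hZ : SmoothVF Z) :
    mlieBracket 𝓘(ℝ, E) X (fun x ↦ A x (Z x)) x₀ - A x₀ (mlieBracket 𝓘(ℝ, E) X Z x₀) =
      chartLieDeriv x₀ X A (Z x₀) := by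
  set u₀ : E := extChartAt 𝓘(ℝ, E) x₀ x₀ with hu₀
  have h1 : chartVF x₀ (fun x ↦ A x (Z x)) =ᶠ[𝓝 u₀] fun u ↦ chartEnd x₀ A u (chartVF x₀ Z u) := by
    filter_upwards [extChartAt_target_mem_nhds (I := 𝓘(ℝ, E)) x₀] with u hu
    exact chartVF_apply hu A Z
  have h2 : HasFDerivAt (chartEnd x₀ A) (fderiv ℝ (chartEnd x₀ A) u₀) u₀ :=
    ((contDiffAt_chartEnd hA).differentiableAt (by simp)).hasFDerivAt
  have h3 : HasFDerivAt (chartVF x₀ Z) (fderiv ℝ (chartVF x₀ Z) u₀) u₀ :=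
    ((contDiffAt_chartVF hZ).differentiableAt (by simp)).hasFDerivAt
  have h4 := h1.fderiv_eq.trans (h2.clm_apply h3).fderiv
  -- All terms are rewritten as vectors of the model space `E`.
  have eX : X x₀ = chartVF x₀ X u₀ := (chartVF_self x₀ X).symm
  have eZ : Z x₀ = chartVF x₀ Z u₀ := (chartVF_self x₀ Z).symm
  have eA : A x₀ = chartEnd x₀ A u₀ := (chartEnd_self x₀ A).symm
  have key : ∀ (v z : E) (a : E →L[ℝ] E), v = chartVF x₀ X u₀ → z = chartVF x₀ Z u₀ →
      a = chartEnd x₀ A u₀ →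
      (fderiv ℝ (chartVF x₀ (fun x ↦ A x (Z x))) u₀ v - fderiv ℝ (chartVF x₀ X) u₀ (a z)) -
        a (fderiv ℝ (chartVF x₀ Z) u₀ v - fderiv ℝ (chartVF x₀ X) u₀ z) =
      chartLieDeriv x₀ X A z := by
    rintro v z a rfl rfl rfl
    rw [h4, chartLieDeriv]
    simp only [add_apply, sub_apply, ContinuousLinearMap.comp_apply, map_sub, ← hu₀,
      ContinuousLinearMap.flip_apply]
    abel
  rw [mlieBracket_eq_chart, mlieBracket_eq_chart]
  exact key _ _ _ eX eZ eA

/-- If `F : ℝ × E → E` is smooth near `(0, u₀)` and `∂F/∂t (0, u) = X u`, then the differential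
`∂F/∂u (t, u₀)` has the derivative `dX` at `t = 0`, by the symmetry of second derivatives. -/
theorem hasDerivAt_fderiv_of_timeDeriv {F : ℝ × E → E} {u₀ : E} (hF : ContDiffAt ℝ ∞ F (0, u₀))
    {X : E → E} (hX : ∀ᶠ u in 𝓝 u₀, HasDerivAt (fun t : ℝ ↦ F (t, u)) (X u) 0) :
    HasDerivAt (fun t : ℝ ↦ fderiv ℝ (fun u ↦ F (t, u)) u₀) (fderiv ℝ X u₀) 0 := by
  have two_le_infty : (2 : ℕ∞ω) ≤ ∞ := WithTop.coe_le_coe.2 le_top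
  have hF1 : ∀ᶠ p in 𝓝 ((0 : ℝ), u₀), DifferentiableAt ℝ F p := by
    filter_upwards [(hF.of_le (m := 1) (by exact_mod_cast le_top)).eventually (by simp)] with p hp
    exact hp.differentiableAt (by simp)
  have hF2 : HasFDerivAt (fderiv ℝ F) (fderiv ℝ (fderiv ℝ F) (0, u₀)) (0, u₀) :=
    ((hF.fderiv_right (m := 1)
      (by simpa [one_add_one_eq_two] using two_le_infty)).differentiableAt (by simp)).hasFDerivAt
  have hsymm := hF.isSymmSndFDerivAt (by simpa using two_le_infty)
  have ht : Filter.Tendsto (fun t : ℝ ↦ (t, u₀)) (𝓝 0) (𝓝 (0, u₀)) :=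
    (Continuous.prodMk_left u₀).tendsto 0
  have hu : Filter.Tendsto (fun u : E ↦ ((0 : ℝ), u)) (𝓝 u₀) (𝓝 (0, u₀)) :=
    (Continuous.prodMk_right (0 : ℝ)).tendsto u₀
  have e1 : (fun t : ℝ ↦ fderiv ℝ (fun u ↦ F (t, u)) u₀) =ᶠ[𝓝 0]
      fun t ↦ fderiv ℝ F (t, u₀) ∘L ContinuousLinearMap.inr ℝ ℝ E := by
    filter_upwards [ht.eventually hF1] with t h
    exact (h.hasFDerivAt.comp u₀ (hasFDerivAt_prodMk_right t u₀)).fderiv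
  have e2 : X =ᶠ[𝓝 u₀] fun u ↦ fderiv ℝ F (0, u) (1, 0) := by
    filter_upwards [hX, hu.eventually hF1] with u h1 h2
    refine h1.unique ?_
    have := h2.hasFDerivAt.comp_hasDerivAt (0 : ℝ)
      (hasFDerivAt_prodMk_left (𝕜 := ℝ) (0 : ℝ) u).hasDerivAt
    simpa [Function.comp_def] using this
  have d2 : fderiv ℝ X u₀ =
      fderiv ℝ (fderiv ℝ F) (0, u₀) (1, 0) ∘L ContinuousLinearMap.inr ℝ ℝ E := by
    have h1 := hF2.comp u₀ (hasFDerivAt_prodMk_right (0 : ℝ) u₀)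
    rw [e2.fderiv_eq]
    have h2 := (h1.clm_apply (hasFDerivAt_const ((1 : ℝ), (0 : E)) u₀)).fderiv
    refine h2.trans ?_
    ext v
    simpa using hsymm (0, v) (1, 0)
  rw [d2]
  refine HasDerivAt.congr_of_eventuallyEq ?_ e1
  have h1 := hF2.comp_hasDerivAt (0 : ℝ) (hasFDerivAt_prodMk_left (𝕜 := ℝ) (0 : ℝ) u₀).hasDerivAt
  have h2 := h1.clm_comp (hasDerivAt_const (0 : ℝ) (ContinuousLinearMap.inr ℝ ℝ E))
  simpa using h2

end

/-! ### Volume elements and connections -/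

section

section Determinant

variable {V ι : Type*} [Fintype ι] [DecidableEq ι]

/-- Letting `L` act on each of the arguments of a determinant in turn multiplies it with the trace
of `L`. -/
theorem sum_det_update [AddCommGroup V] [Module ℝ V] (b : Module.Basis ι ℝ V) (L : V →ₗ[ℝ] V)
    (v : ι → V) :
    ∑ i, b.det (Function.update v i (L (v i))) = LinearMap.trace ℝ V L * b.det v := by
  have h : ∀ i, b.det (Function.update v i (L (v i))) =
      ((b.toMatrix v).adjugate * (LinearMap.toMatrix b b L * b.toMatrix v)) i i := by
    intro i
    rw [Module.Basis.det_apply, Module.Basis.toMatrix_update, ← Matrix.cramer_apply,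
      Matrix.cramer_eq_adjugate_mulVec, Matrix.mul_apply']
    rw [Matrix.mulVec]
    congr 1
    funext j
    rw [← LinearMap.toMatrix_mulVec_repr b b L (v i)]
    rfl
  calc ∑ i, b.det (Function.update v i (L (v i)))
      = ((b.toMatrix v).adjugate * (LinearMap.toMatrix b b L * b.toMatrix v)).trace :=
        Finset.sum_congr rfl fun i _ ↦ h i
    _ = LinearMap.trace ℝ V L * b.det v := by
        rw [Matrix.trace_mul_comm, Matrix.mul_assoc, Matrix.mul_adjugate, Matrix.mul_smul,
          Matrix.mul_one, Matrix.trace_smul, ← LinearMap.trace_eq_matrix_trace,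
          Module.Basis.det_apply, smul_eq_mul, mul_comm]

/-- The determinant in a basis, as a continuous multilinear map. -/
def detCMM [NormedAddCommGroup V] [NormedSpace ℝ V] [FiniteDimensional ℝ V]
    (b : Module.Basis ι ℝ V) : ContinuousMultilinearMap ℝ (fun _ : ι ↦ V) ℝ where
  toMultilinearMap := b.det.toMultilinearMap
  cont := by
    change Continuous fun v ↦ b.det v
    simp only [Module.Basis.det_apply]
    refine Continuous.matrix_det (continuous_matrix fun i j ↦ ?_)
    exact (LinearMap.continuous_of_finiteDimensional (b.coord i)).comp (continuous_apply j)

theorem detCMM_apply [NormedAddCommGroup V] [NormedSpace ℝ V] [FiniteDimensional ℝ V]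
    (b : Module.Basis ι ℝ V) (v : ι → V) : detCMM b v = b.det v := rfl

end Determinant

/-- Letting `L` act on each of the arguments of a form of top degree in turn multiplies it with the
trace of `L`. -/
theorem sum_apply_update {V : Type*} [AddCommGroup V] [Module ℝ V] [TopologicalSpace V]
    [FiniteDimensional ℝ V] (f : V [⋀^Fin (Module.finrank ℝ V)]→ₗ[ℝ] ℝ) (L : V →L[ℝ] V)
    (v : Fin (Module.finrank ℝ V) → V) :
    ∑ i, f (Function.update v i (L (v i))) = tr L * f v := by
  have h := f.eq_smul_basis_det (Module.finBasis ℝ V)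
  rw [h]
  simp only [AlternatingMap.smul_apply, smul_eq_mul, ← Finset.mul_sum]
  have h2 := sum_det_update (Module.finBasis ℝ V) (L : V →ₗ[ℝ] V) v
  simp only [ContinuousLinearMap.coe_coe] at h2
  rw [h2, tr]
  ring

variable {E : Type*} [NormedAddCommGroup E] [NormedSpace ℝ E] [FiniteDimensional ℝ E]
  {M : Type*} [TopologicalSpace M] [ChartedSpace E M] [IsManifold 𝓘(ℝ, E) ∞ M]

theorem mvfderiv_eq_chart {f : M → ℝ} {x₀ : M} (hf : MDifferentiableAt 𝓘(ℝ, E) 𝓘(ℝ, ℝ) f x₀)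
    (v : TangentSpace 𝓘(ℝ, E) x₀) :
    mvfderiv 𝓘(ℝ, E) f x₀ v =
      fderiv ℝ (f ∘ (extChartAt 𝓘(ℝ, E) x₀).symm) (extChartAt 𝓘(ℝ, E) x₀ x₀) v := by
  let f' : E →L[ℝ] ℝ := mfderiv 𝓘(ℝ, E) 𝓘(ℝ, ℝ) f x₀
  have h : HasFDerivWithinAt (f ∘ (extChartAt 𝓘(ℝ, E) x₀).symm) f' univ
      (extChartAt 𝓘(ℝ, E) x₀ x₀) := by
    have h1 := hf.hasMFDerivAt.2
    rw [modelWithCornersSelf_coe, range_id] at h1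
    exact h1
  exact congrArg (fun A : E →L[ℝ] ℝ ↦ A v) (hasFDerivWithinAt_univ.1 h).fderiv.symm

theorem differentiableAt_chartVF {Y : Π x : M, TangentSpace 𝓘(ℝ, E) x} {x₀ : M}
    (hY : MDiffAt (T% Y) x₀) :
    DifferentiableAt ℝ (chartVF x₀ Y) (extChartAt 𝓘(ℝ, E) x₀ x₀) := by
  have h := (mdifferentiableAt_section _ Y).1 hY
  have h2 := MDifferentiableWithinAt.differentiableWithinAt_comp_extChartAt_symm
    (mdifferentiableWithinAt_univ.2 h)
  simp only [preimage_univ, univ_inter, modelWithCornersSelf_coe, range_id,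
    differentiableWithinAt_univ] at h2
  exact h2

theorem differentiableAt_comp_chart {f : M → ℝ} {x₀ : M}
    (hf : MDifferentiableAt 𝓘(ℝ, E) 𝓘(ℝ, ℝ) f x₀) :
    DifferentiableAt ℝ (f ∘ (extChartAt 𝓘(ℝ, E) x₀).symm) (extChartAt 𝓘(ℝ, E) x₀ x₀) := by
  have h2 := MDifferentiableWithinAt.differentiableWithinAt_comp_extChartAt_symm
    (mdifferentiableWithinAt_univ.2 hf)
  simpa only [preimage_univ, univ_inter, modelWithCornersSelf_coe, range_id,
    differentiableWithinAt_univ] using h2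

theorem chartVF_add (x₀ : M) (Y Z : Π x : M, TangentSpace 𝓘(ℝ, E) x) :
    chartVF x₀ (Y + Z) =ᶠ[𝓝 (extChartAt 𝓘(ℝ, E) x₀ x₀)] chartVF x₀ Y + chartVF x₀ Z := by
  filter_upwards [extChartAt_target_mem_nhds (I := 𝓘(ℝ, E)) x₀] with u hu
  have hy : (extChartAt 𝓘(ℝ, E) x₀).symm u ∈
      (trivializationAt E (TangentSpace 𝓘(ℝ, E) : M → Type _) x₀).baseSet := by
    simpa using (extChartAt 𝓘(ℝ, E) x₀).map_target hu
  exact ((trivializationAt E (TangentSpace 𝓘(ℝ, E) : M → Type _) x₀).linear ℝ hy).map_add _ _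

theorem chartVF_smul (x₀ : M) (f : M → ℝ) (Y : Π x : M, TangentSpace 𝓘(ℝ, E) x) :
    chartVF x₀ (f • Y) =ᶠ[𝓝 (extChartAt 𝓘(ℝ, E) x₀ x₀)]
      (f ∘ (extChartAt 𝓘(ℝ, E) x₀).symm) • chartVF x₀ Y := by
  filter_upwards [extChartAt_target_mem_nhds (I := 𝓘(ℝ, E)) x₀] with u hu
  have hy : (extChartAt 𝓘(ℝ, E) x₀).symm u ∈
      (trivializationAt E (TangentSpace 𝓘(ℝ, E) : M → Type _) x₀).baseSet := by
    simpa using (extChartAt 𝓘(ℝ, E) x₀).map_target hu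
  exact ((trivializationAt E (TangentSpace 𝓘(ℝ, E) : M → Type _) x₀).linear ℝ hy).map_smul _ _

/-- The derivative of a vector field at `x₀` with respect to the flat connection of the preferred
chart at `x₀`. -/
def chartDeriv (x₀ : M) (Y : Π x : M, TangentSpace 𝓘(ℝ, E) x) (v : TangentSpace 𝓘(ℝ, E) x₀) :
    TangentSpace 𝓘(ℝ, E) x₀ :=
  fderiv ℝ (chartVF x₀ Y) (extChartAt 𝓘(ℝ, E) x₀ x₀) v

theorem chartDeriv_add {x₀ : M} {Y Z : Π x : M, TangentSpace 𝓘(ℝ, E) x} (hY : MDiffAt (T% Y) x₀)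
    (hZ : MDiffAt (T% Z) x₀) (v : TangentSpace 𝓘(ℝ, E) x₀) :
    chartDeriv x₀ (Y + Z) v = chartDeriv x₀ Y v + chartDeriv x₀ Z v := by
  have h := (chartVF_add x₀ Y Z).fderiv_eq.trans
    (fderiv_add (differentiableAt_chartVF hY) (differentiableAt_chartVF hZ))
  exact congrArg (fun A : E →L[ℝ] E ↦ A v) h

theorem chartDeriv_smul {x₀ : M} {f : M → ℝ} {Y : Π x : M, TangentSpace 𝓘(ℝ, E) x}
    (hf : MDifferentiableAt 𝓘(ℝ, E) 𝓘(ℝ, ℝ) f x₀) (hY : MDiffAt (T% Y) x₀)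
    (v : TangentSpace 𝓘(ℝ, E) x₀) :
    chartDeriv x₀ (f • Y) v = f x₀ • chartDeriv x₀ Y v + mvfderiv 𝓘(ℝ, E) f x₀ v • Y x₀ := by
  have h := (chartVF_smul x₀ f Y).fderiv_eq.trans
    (fderiv_smul (differentiableAt_comp_chart hf) (differentiableAt_chartVF hY))
  rw [mvfderiv_eq_chart hf]
  refine (congrArg (fun A : E →L[ℝ] E ↦ A v) h).trans ?_
  have h1 := chartVF_self x₀ Y
  have h2 : (f ∘ (extChartAt 𝓘(ℝ, E) x₀).symm) (extChartAt 𝓘(ℝ, E) x₀ x₀) = f x₀ :=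
    congrArg f (extChartAt_to_inv x₀)
  have key : ∀ (c c' : ℝ) (y y' : E), c = c' → y = y' → ∀ (A : E →L[ℝ] E) (B : E →L[ℝ] ℝ) (v : E),
      (c • A + B.smulRight y) v = c' • A v + B v • y' := by
    rintro c c' y y' rfl rfl A B v
    rfl
  exact key _ _ _ _ h2 h1 _ _ _

/-- The difference of a connection and the flat connection of a chart is a tensor. -/
theorem sub_chartDeriv_tensorial (D : Connection E M) (x₀ : M) (v : TangentSpace 𝓘(ℝ, E) x₀) :
    TensorialAt 𝓘(ℝ, E) E
      (fun Y : Π x : M, TangentSpace 𝓘(ℝ, E) x ↦ D Y x₀ v - chartDeriv x₀ Y v) x₀ where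
  smul {f Y} hf hY := by
    rw [D.isCovariantDerivativeOnUniv.leibniz hY hf, chartDeriv_smul hf hY]
    simp only [add_apply, smul_apply, ContinuousLinearMap.smulRight_apply]
    module
  add {Y Z} hY hZ := by
    rw [D.isCovariantDerivativeOnUniv.add hY hZ, chartDeriv_add hY hZ, add_apply]
    abel

/-- In the frame given by a basis `b` of the model space near `x₀`, a form of top degree is a
function times the determinant. -/
theorem topForm_eq_smul_det {ι : Type*} [Fintype ι] [DecidableEq ι] (b : Module.Basis ι ℝ E)
    {x₀ y : M} (hy : y ∈ (trivializationAt E (TangentSpace 𝓘(ℝ, E) : M → Type _) x₀).baseSet)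
    (f : TangentSpace 𝓘(ℝ, E) y [⋀^ι]→ₗ[ℝ] ℝ) (v : ι → TangentSpace 𝓘(ℝ, E) y) :
    f v = f (fun i ↦ (trivializationAt E (TangentSpace 𝓘(ℝ, E)) x₀).symm y (b i)) *
      b.det (fun i ↦ (trivializationAt E (TangentSpace 𝓘(ℝ, E)) x₀ ⟨y, v i⟩).2) := by
  set t := trivializationAt E (TangentSpace 𝓘(ℝ, E) : M → Type _) x₀ with ht
  let g : E [⋀^ι]→ₗ[ℝ] ℝ := f.compLinearMap
    ((t.continuousLinearEquivAt ℝ y hy).symm : E →L[ℝ] TangentSpace 𝓘(ℝ, E) y).toLinearMap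
  have h := congrArg (fun g : E [⋀^ι]→ₗ[ℝ] ℝ ↦ g (fun i ↦ (t ⟨y, v i⟩).2)) (g.eq_smul_basis_det b)
  refine Eq.trans ?_ h
  refine congrArg f (funext fun i ↦ ?_)
  exact ((t.continuousLinearEquivAt ℝ y hy).symm_apply_apply (v i)).symm

theorem SmoothVF.covDeriv {D : Connection E M}
    (hD : CovariantDerivative.ContMDiffCovariantDerivative D ∞)
    {Y Z : Π x : M, TangentSpace 𝓘(ℝ, E) x} (hY : SmoothVF Y) (hZ : SmoothVF Z) :
    SmoothVF (fun x ↦ D Z x (Y x)) := by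
  have h : SmoothEndOn (fun x ↦ D Z x) univ := hD.contMDiff.contMDiff (σ := Z) hZ.contMDiffOn
  exact h.apply hY

theorem contMDiff_mvfderiv_apply {f : M → ℝ} (hf : ContMDiff 𝓘(ℝ, E) 𝓘(ℝ, ℝ) ∞ f)
    {Y : Π x : M, TangentSpace 𝓘(ℝ, E) x} (hY : SmoothVF Y) :
    ContMDiff 𝓘(ℝ, E) 𝓘(ℝ, ℝ) ∞ (fun x ↦ mvfderiv 𝓘(ℝ, E) f x (Y x)) :=
  (contMDiff_snd_tangentBundle_modelSpace ℝ 𝓘(ℝ, ℝ)).comp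
    ((hf.contMDiff_tangentMap (m := ∞) (by simp)).comp hY)

section VolumeElement

variable [T2Space M] {ν : TopForm E M}

theorem IsVolumeElement.exists_frame (hν : IsVolumeElement ν) (x₀ : M) :
    ∃ e : Fin (Module.finrank ℝ E) → Π x : M, TangentSpace 𝓘(ℝ, E) x, (∀ i, SmoothVF (e i)) ∧
      ν x₀ (fun i ↦ e i x₀) ≠ 0 := by
  set b := Module.finBasis ℝ E
  obtain ⟨e, he, hev⟩ := exists_smooth_frame b x₀
  refine ⟨e, he, fun h0 ↦ hν.ne_zero x₀ ?_⟩
  ext w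
  rw [topForm_eq_smul_det b (FiberBundle.mem_baseSet_trivializationAt E
    (TangentSpace 𝓘(ℝ, E) : M → Type _) x₀) (ν x₀) w]
  simp only [← (hev _).self_of_nhds, h0, zero_mul, AlternatingMap.zero_apply]

/-- The covariant derivative of a volume element is a multiple of it. -/
theorem IsVolumeElement.exists_covDeriv_eq (hν : IsVolumeElement ν) (D : Connection E M) (x₀ : M)
    (v : TangentSpace 𝓘(ℝ, E) x₀) :
    ∃ c : ℝ, ∀ Y : Fin (Module.finrank ℝ E) → Π x : M, TangentSpace 𝓘(ℝ, E) x,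
      (∀ i, SmoothVF (Y i)) → mvfderiv 𝓘(ℝ, E) (fun y ↦ ν y (fun i ↦ Y i y)) x₀ v
        - ∑ i, ν x₀ (Function.update (fun j ↦ Y j x₀) i (D (Y i) x₀ v)) =
        c * ν x₀ (fun j ↦ Y j x₀) := by
  set b := Module.finBasis ℝ E
  obtain ⟨e, he, hev⟩ := exists_smooth_frame b x₀
  set u₀ : E := extChartAt 𝓘(ℝ, E) x₀ x₀ with hu₀
  have hsm : ∀ Y : Fin (Module.finrank ℝ E) → Π x : M, TangentSpace 𝓘(ℝ, E) x,
      (∀ i, SmoothVF (Y i)) →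
        MDifferentiableAt 𝓘(ℝ, E) 𝓘(ℝ, ℝ) (fun y ↦ ν y (fun i ↦ Y i y)) x₀ :=
    fun Y hY ↦ (hν.smooth Y hY x₀).mdifferentiableAt (by simp)
  let h : M → ℝ := fun y ↦ ν y (fun i ↦ e i y)
  set Γ := TensorialAt.mkHom _ x₀ (sub_chartDeriv_tensorial D x₀ v) with hΓ
  -- The form is `h` times the determinant in the coordinates of the chart.
  have hdet : ∀ᶠ y in 𝓝 x₀, ∀ w : Fin (Module.finrank ℝ E) → TangentSpace 𝓘(ℝ, E) y,
      ν y w = h y * b.det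
        (fun i ↦ (trivializationAt E (TangentSpace 𝓘(ℝ, E)) x₀ ⟨y, w i⟩).2) := by
    have hx := FiberBundle.mem_baseSet_trivializationAt E (TangentSpace 𝓘(ℝ, E) : M → Type _) x₀
    filter_upwards [Filter.eventually_all.2 hev,
      (trivializationAt E (TangentSpace 𝓘(ℝ, E) : M → Type _) x₀).open_baseSet.mem_nhds hx]
      with y hy hyb w
    rw [topForm_eq_smul_det b hyb (ν y) w]
    simp only [h, hy]
  have hdet₀ : ∀ w : Fin (Module.finrank ℝ E) → TangentSpace 𝓘(ℝ, E) x₀,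
      ν x₀ w = h x₀ * b.det (fun i ↦ (w i : E)) := by
    intro w
    rw [hdet.self_of_nhds w]
    congr 2
    funext i
    exact trivializationAt_self_apply x₀ (w i)
  have hh0 : h x₀ ≠ 0 := fun h0 ↦ hν.ne_zero x₀ (by ext w; rw [hdet₀, h0, zero_mul]; rfl)
  -- The flat connection of the chart contributes `dh / h`, its difference `Γ` to `D` a trace.
  refine ⟨mvfderiv 𝓘(ℝ, E) h x₀ v / h x₀ - tr Γ, fun Y hY ↦ ?_⟩
  have hΓY : ∀ i, D (Y i) x₀ v = chartDeriv x₀ (Y i) v + Γ (Y i x₀) := by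
    intro i
    rw [hΓ, TensorialAt.mkHom_apply _ ((hY i).mdifferentiableAt x₀)]
    abel
  have hchart : (fun y ↦ ν y (fun i ↦ Y i y)) ∘ (extChartAt 𝓘(ℝ, E) x₀).symm =ᶠ[𝓝 u₀]
      fun u ↦ (h ∘ (extChartAt 𝓘(ℝ, E) x₀).symm) u * detCMM b (fun i ↦ chartVF x₀ (Y i) u) := by
    have hc : Filter.Tendsto (extChartAt 𝓘(ℝ, E) x₀).symm (𝓝 u₀) (𝓝 x₀) := by
      have := continuousAt_extChartAt_symm (I := 𝓘(ℝ, E)) x₀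
      rwa [ContinuousAt, extChartAt_to_inv] at this
    filter_upwards [hc.eventually hdet] with u hu
    exact hu _
  have hder := ((differentiableAt_comp_chart (hsm e he)).hasFDerivAt.mul
    (HasFDerivAt.multilinear_comp (f := detCMM b) fun i ↦
      (differentiableAt_chartVF ((hY i).mdifferentiableAt x₀)).hasFDerivAt)).congr_of_eventuallyEq
    hchart
  have hval : mvfderiv 𝓘(ℝ, E) (fun y ↦ ν y (fun i ↦ Y i y)) x₀ v =
      ∑ i, ν x₀ (Function.update (fun j ↦ Y j x₀) i (chartDeriv x₀ (Y i) v)) +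
        mvfderiv 𝓘(ℝ, E) h x₀ v / h x₀ * ν x₀ (fun j ↦ Y j x₀) := by
    simp only [hdet₀]
    rw [mvfderiv_eq_chart (hsm Y hY), mvfderiv_eq_chart (hsm e he), ← Finset.mul_sum]
    have hd := congrArg (fun A : E →L[ℝ] ℝ ↦ A v) hder.fderiv
    refine hd.trans ?_
    have e1 : (h ∘ (extChartAt 𝓘(ℝ, E) x₀).symm) u₀ = h x₀ := congrArg h (extChartAt_to_inv x₀)
    have e2 : (fun i ↦ chartVF x₀ (Y i) u₀) = fun i ↦ (Y i x₀ : E) :=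
      funext fun i ↦ chartVF_self x₀ (Y i)
    have key : ∀ (c : ℝ) (y y' : Fin (Module.finrank ℝ E) → E), c = h x₀ → y = y' →
        ∀ (A : Fin (Module.finrank ℝ E) → E →L[ℝ] E) (B : E →L[ℝ] ℝ) (v : E),
        (c • (∑ i, (detCMM b).toContinuousLinearMap y i ∘L A i) + detCMM b y • B) v =
          h x₀ * ∑ i, b.det (Function.update y' i (A i v)) + B v / h x₀ * (h x₀ * b.det y') := by
      rintro c y y' rfl rfl A B v
      simp only [add_apply, smul_apply, sum_apply, ContinuousLinearMap.comp_apply, smul_eq_mul,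
        ContinuousMultilinearMap.toContinuousLinearMap_apply, detCMM_apply]
      field_simp
    exact key _ _ _ e1 e2 _ _ _
  have hsum : ∑ i, ν x₀ (Function.update (fun j ↦ Y j x₀) i (Γ (Y i x₀))) =
      tr Γ * ν x₀ (fun j ↦ Y j x₀) :=
    sum_apply_update (V := TangentSpace 𝓘(ℝ, E) x₀) (ν x₀) Γ (fun j ↦ Y j x₀)
  rw [hval]
  simp only [hΓY, AlternatingMap.map_update_add, Finset.sum_add_distrib]
  linear_combination -hsum

/-- The connection form of the connection induced on forms of top degree, with respect to a volume
element. -/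
theorem IsVolumeElement.exists_connectionForm (hν : IsVolumeElement ν) (D : Connection E M)
    (x₀ : M) : ∃ α : TangentSpace 𝓘(ℝ, E) x₀ →L[ℝ] ℝ,
      ∀ Y : Fin (Module.finrank ℝ E) → Π x : M, TangentSpace 𝓘(ℝ, E) x, (∀ i, SmoothVF (Y i)) →
      ∀ v, mvfderiv 𝓘(ℝ, E) (fun y ↦ ν y (fun i ↦ Y i y)) x₀ v
        - ∑ i, ν x₀ (Function.update (fun j ↦ Y j x₀) i (D (Y i) x₀ v)) =
        α v * ν x₀ (fun j ↦ Y j x₀) := by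
  obtain ⟨e, he, he0⟩ := hν.exists_frame x₀
  let l : TangentSpace 𝓘(ℝ, E) x₀ →ₗ[ℝ] ℝ :=
    { toFun := fun v ↦ mvfderiv 𝓘(ℝ, E) (fun y ↦ ν y (fun i ↦ e i y)) x₀ v
        - ∑ i, ν x₀ (Function.update (fun j ↦ e j x₀) i (D (e i) x₀ v))
      map_add' := fun v w ↦ by
        simp only [map_add, AlternatingMap.map_update_add, Finset.sum_add_distrib]; ring
      map_smul' := fun c v ↦ by
        simp only [map_smul, AlternatingMap.map_update_smul, smul_eq_mul, RingHom.id_apply]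
        rw [← Finset.mul_sum, mul_sub] }
  refine ⟨LinearMap.toContinuousLinearMap ((ν x₀ (fun j ↦ e j x₀))⁻¹ • l), fun Y hY v ↦ ?_⟩
  obtain ⟨c, hc⟩ := hν.exists_covDeriv_eq D x₀ v
  rw [hc Y hY]
  congr 1
  have h := hc e he
  change c = (ν x₀ (fun j ↦ e j x₀))⁻¹ * (mvfderiv 𝓘(ℝ, E) (fun y ↦ ν y (fun i ↦ e i y)) x₀ v
        - ∑ i, ν x₀ (Function.update (fun j ↦ e j x₀) i (D (e i) x₀ v)))
  rw [h]
  field_simp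

/-- The connection form `α` with `D_v ν = α(v) ν`. -/
def IsVolumeElement.connectionForm (hν : IsVolumeElement ν) (D : Connection E M) (x : M) :
    TangentSpace 𝓘(ℝ, E) x →L[ℝ] ℝ :=
  (hν.exists_connectionForm D x).choose

theorem IsVolumeElement.connectionForm_spec (hν : IsVolumeElement ν) (D : Connection E M) (x : M)
    {Y : Fin (Module.finrank ℝ E) → Π x : M, TangentSpace 𝓘(ℝ, E) x} (hY : ∀ i, SmoothVF (Y i))
    (v : TangentSpace 𝓘(ℝ, E) x) :
    mvfderiv 𝓘(ℝ, E) (fun y ↦ ν y (fun i ↦ Y i y)) x v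
        - ∑ i, ν x (Function.update (fun j ↦ Y j x) i (D (Y i) x v)) =
      hν.connectionForm D x v * ν x (fun j ↦ Y j x) :=
  (hν.exists_connectionForm D x).choose_spec Y hY v

theorem IsVolumeElement.contMDiff_apply_update (hν : IsVolumeElement ν)
    {Y : Fin (Module.finrank ℝ E) → Π x : M, TangentSpace 𝓘(ℝ, E) x} (hY : ∀ i, SmoothVF (Y i))
    (i : Fin (Module.finrank ℝ E)) {Z : Π x : M, TangentSpace 𝓘(ℝ, E) x} (hZ : SmoothVF Z) :
    ContMDiff 𝓘(ℝ, E) 𝓘(ℝ, ℝ) ∞ (fun x ↦ ν x (Function.update (fun j ↦ Y j x) i (Z x))) := by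
  have h := hν.smooth (Function.update Y i Z) fun j ↦ by
    by_cases hj : j = i
    · subst hj; simpa using hZ
    · simpa [hj] using hY j
  refine h.congr fun x ↦ ?_
  congr 1
  funext j
  by_cases hj : j = i
  · subst hj; simp
  · simp [hj]

theorem IsVolumeElement.contMDiff_connectionForm (hν : IsVolumeElement ν) {D : Connection E M}
    (hD : CovariantDerivative.ContMDiffCovariantDerivative D ∞)
    {Y : Π x : M, TangentSpace 𝓘(ℝ, E) x} (hY : SmoothVF Y) :
    ContMDiff 𝓘(ℝ, E) 𝓘(ℝ, ℝ) ∞ (fun x ↦ hν.connectionForm D x (Y x)) := by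
  intro x₀
  obtain ⟨e, he, he0⟩ := hν.exists_frame x₀
  have h1 : ContMDiff 𝓘(ℝ, E) 𝓘(ℝ, ℝ) ∞ (fun x ↦
      mvfderiv 𝓘(ℝ, E) (fun y ↦ ν y (fun i ↦ e i y)) x (Y x)
        - ∑ i, ν x (Function.update (fun j ↦ e j x) i (D (e i) x (Y x)))) :=
    (contMDiff_mvfderiv_apply (hν.smooth e he) hY).sub
      (ContMDiff.sum fun i _ ↦ hν.contMDiff_apply_update he i (hY.covDeriv hD (he i)))
  refine ((h1 x₀).div₀ (hν.smooth e he x₀) he0).congr_of_eventuallyEq ?_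
  filter_upwards [(hν.smooth e he).continuous.continuousAt.eventually_ne he0] with x hx
  exact (eq_div_iff hx).2 (hν.connectionForm_spec D x he (Y x)).symm

/-- A volume element is parallel for the connection obtained from `D` by the correction with the
one-form `α / (m + 4)`, where `α` is its connection form for `D` and `m` is the dimension of
`M`. -/
theorem IsVolumeElement.parallel_addOneForm_correction (hν : IsVolumeElement ν) (D : Connection E M)
    {Q : Π x : M, Submodule ℝ (EndT E x)} (hQ : IsAlmostQuaternionic Q)
    {Y : Fin (Module.finrank ℝ E) → Π x : M, TangentSpace 𝓘(ℝ, E) x} (hY : ∀ i, SmoothVF (Y i))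
    (x : M) (v : TangentSpace 𝓘(ℝ, E) x) :
    mvfderiv 𝓘(ℝ, E) (fun y ↦ ν y (fun i ↦ Y i y)) x v =
      ∑ i, ν x (Function.update (fun j ↦ Y j x) i (D.addOneForm (hQ.correction
        fun x ↦ ((Module.finrank ℝ E : ℝ) + 4)⁻¹ • hν.connectionForm D x) (Y i) x v)) := by
  set ξ : Π x : M, TangentSpace 𝓘(ℝ, E) x →L[ℝ] ℝ :=
    fun x ↦ ((Module.finrank ℝ E : ℝ) + 4)⁻¹ • hν.connectionForm D x with hξ
  have h0 : ∀ i, D.addOneForm (hQ.correction ξ) (Y i) x v =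
      D (Y i) x v + hQ.correction ξ x v (Y i x) := fun i ↦ by
    rw [← hQ.correction_symm ξ x (Y i x) v]; rfl
  have h1 := hν.connectionForm_spec D x hY v
  have h2 : ∑ i, ν x (Function.update (fun j ↦ Y j x) i (hQ.correction ξ x v (Y i x))) =
      tr (hQ.correction ξ x v) * ν x (fun j ↦ Y j x) :=
    sum_apply_update (V := TangentSpace 𝓘(ℝ, E) x) (ν x) _ (fun j ↦ Y j x)
  have h3 : tr (hQ.correction ξ x v) = hν.connectionForm D x v := by
    rw [hQ.tr_correction, hξ, smul_apply, smul_eq_mul]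
    field_simp
  simp only [h0, AlternatingMap.map_update_add, Finset.sum_add_distrib]
  rw [h2, h3]
  linear_combination h1

end VolumeElement

end

/-! ### Local flows in a chart -/

section

variable {E : Type*} [NormedAddCommGroup E] [NormedSpace ℝ E] [FiniteDimensional ℝ E]
  {M : Type*} [TopologicalSpace M] [ChartedSpace E M] [IsManifold 𝓘(ℝ, E) ∞ M]

/-- The local flow `φ`, read in the preferred chart at `x₀`. -/
def chartFlow (x₀ : M) (φ : ℝ → M → M) (p : ℝ × E) : E :=
  extChartAt 𝓘(ℝ, E) x₀ (φ p.1 ((extChartAt 𝓘(ℝ, E) x₀).symm p.2))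

namespace IsLocalFlow

variable {X : Π x : M, TangentSpace 𝓘(ℝ, E) x} {φ : ℝ → M → M} {ε : ℝ} {U : Set M}

theorem zero_mem (h : IsLocalFlow X φ ε U) : (0 : ℝ) ∈ Ioo (-ε) ε := ⟨by linarith [h.pos], h.pos⟩

theorem contMDiffAt (h : IsLocalFlow X φ ε U) {t : ℝ} (ht : t ∈ Ioo (-ε) ε) {x : M} (hx : x ∈ U) :
    ContMDiffAt (𝓘(ℝ, ℝ).prod 𝓘(ℝ, E)) 𝓘(ℝ, E) ∞ (fun p : ℝ × M ↦ φ p.1 p.2) (t, x) :=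
  (h.smooth (t, x) ⟨ht, hx⟩).contMDiffAt ((isOpen_Ioo.prod h.isOpen).mem_nhds ⟨ht, hx⟩)

theorem eventually_mem (h : IsLocalFlow X φ ε U) : ∀ᶠ t in 𝓝 (0 : ℝ), t ∈ Ioo (-ε) ε :=
  isOpen_Ioo.mem_nhds h.zero_mem

theorem contDiffAt_chartFlow (h : IsLocalFlow X φ ε U) {x₀ : M} (hx : x₀ ∈ U) :
    ContDiffAt ℝ ∞ (chartFlow x₀ φ) ((0 : ℝ), extChartAt 𝓘(ℝ, E) x₀ x₀) := by
  set u₀ : E := extChartAt 𝓘(ℝ, E) x₀ x₀ with hu₀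
  have h1 : ContMDiffAt 𝓘(ℝ, E) 𝓘(ℝ, E) ∞ (extChartAt 𝓘(ℝ, E) x₀).symm u₀ :=
    (contMDiffOn_extChartAt_symm x₀).contMDiffAt (extChartAt_target_mem_nhds x₀)
  have h2 : ContMDiffAt 𝓘(ℝ, ℝ × E) (𝓘(ℝ, ℝ).prod 𝓘(ℝ, E)) ∞
      (fun p : ℝ × E ↦ (p.1, (extChartAt 𝓘(ℝ, E) x₀).symm p.2)) ((0 : ℝ), u₀) := by
    refine ContMDiffAt.prodMk ?_ ?_
    · exact contDiffAt_fst.contMDiffAt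
    · exact ContMDiffAt.comp (x := ((0 : ℝ), u₀)) (g := (extChartAt 𝓘(ℝ, E) x₀).symm)
        (f := Prod.snd) h1 contDiffAt_snd.contMDiffAt
  have h3 := h.contMDiffAt h.zero_mem hx
  have hs : (extChartAt 𝓘(ℝ, E) x₀).symm u₀ = x₀ := extChartAt_to_inv x₀
  have h4 : ContMDiffAt 𝓘(ℝ, E) 𝓘(ℝ, E) ∞ (extChartAt 𝓘(ℝ, E) x₀) (φ 0 x₀) := by
    rw [h.zero x₀ hx]; exact contMDiffAt_extChartAt
  have h5 : ContMDiffAt 𝓘(ℝ, ℝ × E) 𝓘(ℝ, E) ∞ (chartFlow x₀ φ) ((0 : ℝ), u₀) := by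
    refine ContMDiffAt.comp_of_eq (g := extChartAt 𝓘(ℝ, E) x₀) (y := φ 0 x₀) h4
      (ContMDiffAt.comp_of_eq (g := fun p : ℝ × M ↦ φ p.1 p.2) h3 h2 ?_) ?_
    · simp only [hs]
    · simp only [hs]
  exact contMDiffAt_iff_contDiffAt.1 h5

theorem eventually_hasDerivAt_chartFlow (h : IsLocalFlow X φ ε U) {x₀ : M} (hx : x₀ ∈ U) :
    ∀ᶠ u in 𝓝 (extChartAt 𝓘(ℝ, E) x₀ x₀ : E),
      HasDerivAt (fun t : ℝ ↦ chartFlow x₀ φ (t, u)) (chartVF x₀ X u) 0 := by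
  have hU : ∀ᶠ u in 𝓝 (extChartAt 𝓘(ℝ, E) x₀ x₀ : E), (extChartAt 𝓘(ℝ, E) x₀).symm u ∈ U :=
    (continuousAt_extChartAt_symm x₀).eventually_mem
      (by rw [extChartAt_to_inv]; exact h.isOpen.mem_nhds hx)
  filter_upwards [hU, extChartAt_target_mem_nhds (I := 𝓘(ℝ, E)) x₀] with u huU hut
  set y := (extChartAt 𝓘(ℝ, E) x₀).symm u with hy
  have hys : y ∈ (chartAt E x₀).source := by
    rw [← extChartAt_source 𝓘(ℝ, E)]; exact (extChartAt 𝓘(ℝ, E) x₀).map_target hut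
  have h1 := (h.integralCurve y huU 0 h.zero_mem).hasMFDerivAt (isOpen_Ioo.mem_nhds h.zero_mem)
  have h0 := h.zero y huU
  have h2 : HasMFDerivAt 𝓘(ℝ, E) 𝓘(ℝ, E) (extChartAt 𝓘(ℝ, E) x₀) (φ 0 y)
      (mfderiv 𝓘(ℝ, E) 𝓘(ℝ, E) (extChartAt 𝓘(ℝ, E) x₀) (φ 0 y)) := by
    rw [h0]; exact (mdifferentiableAt_extChartAt hys).hasMFDerivAt
  have h3 : HasFDerivAt (fun t : ℝ ↦ chartFlow x₀ φ (t, u))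
      (_ : ℝ →L[ℝ] E) 0 := (h2.comp (0 : ℝ) h1).hasFDerivAt
  have h4 : ∀ z, z = y →
      mfderiv 𝓘(ℝ, E) 𝓘(ℝ, E) (extChartAt 𝓘(ℝ, E) x₀) z ((1 : ℝ) • X z) = chartVF x₀ X u := by
    rintro z rfl
    rw [one_smul]
    exact (trivializationAt_apply_eq_mfderiv hys (X y)).symm
  have h5 := hasFDerivAt_iff_hasDerivAt.1 h3
  exact (h4 _ h0) ▸ h5

/-- The differential of the flow, read in the chart. -/
theorem eventually_mfderiv_eq (h : IsLocalFlow X φ ε U) {x₀ : M} (hx : x₀ ∈ U) :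
    ∀ᶠ t in 𝓝 (0 : ℝ), φ t x₀ ∈ (chartAt E x₀).source ∧ ∀ v : TangentSpace 𝓘(ℝ, E) x₀,
      (trivializationAt E (TangentSpace 𝓘(ℝ, E)) x₀
        ⟨φ t x₀, mfderiv 𝓘(ℝ, E) 𝓘(ℝ, E) (φ t) x₀ v⟩).2 =
      fderiv ℝ (fun u ↦ chartFlow x₀ φ (t, u)) (extChartAt 𝓘(ℝ, E) x₀ x₀) v := by
  have hc : ContinuousAt (fun t ↦ φ t x₀) 0 :=
    ((h.integralCurve x₀ hx 0 h.zero_mem).hasMFDerivAt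
      (isOpen_Ioo.mem_nhds h.zero_mem)).continuousAt
  have hsrc : ∀ᶠ t in 𝓝 (0 : ℝ), φ t x₀ ∈ (chartAt E x₀).source :=
    hc.eventually_mem (by
      rw [h.zero x₀ hx]; exact (chartAt E x₀).open_source.mem_nhds (mem_chart_source E x₀))
  filter_upwards [h.eventually_mem, hsrc] with t ht hts
  refine ⟨hts, fun v ↦ ?_⟩
  rw [trivializationAt_apply_eq_mfderiv hts]
  have h1 : MDifferentiableAt 𝓘(ℝ, E) 𝓘(ℝ, E) (φ t) x₀ :=
    ((h.contMDiffAt ht hx).comp x₀ (contMDiffAt_const.prodMk contMDiffAt_id)).mdifferentiableAt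
      (by simp)
  have h2 : MDifferentiableAt 𝓘(ℝ, E) 𝓘(ℝ, E) (extChartAt 𝓘(ℝ, E) x₀) (φ t x₀) :=
    mdifferentiableAt_extChartAt hts
  have h3 := (h2.hasMFDerivAt.comp x₀ h1.hasMFDerivAt)
  have h4 := h3.2
  rw [modelWithCornersSelf_coe, range_id] at h4
  have h5 : HasFDerivAt (fun u ↦ chartFlow x₀ φ (t, u)) (_ : E →L[ℝ] E)
      (extChartAt 𝓘(ℝ, E) x₀ x₀) := hasFDerivWithinAt_univ.1 h4
  exact congrArg (fun A : E →L[ℝ] E ↦ A v) h5.fderiv.symm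

end IsLocalFlow

end

/-! ### Flows and the Lie derivative of sections of `Q` -/

section

section Conjugation

variable {V W : Type*} [AddCommGroup V] [Module ℝ V] [TopologicalSpace V] [IsTopologicalAddGroup V]
  [ContinuousSMul ℝ V] [AddCommGroup W] [Module ℝ W] [TopologicalSpace W] [IsTopologicalAddGroup W]
  [ContinuousSMul ℝ W]

/-- If conjugation with a bijective `Φ` maps `S` to `S'` and the dimensions agree, it is onto. -/
theorem exists_conj_mem {S : Submodule ℝ (V →L[ℝ] V)} {S' : Submodule ℝ (W →L[ℝ] W)}
    (hpos : 0 < Module.finrank ℝ S) (hrank : Module.finrank ℝ S = Module.finrank ℝ S')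
    {Φ : V →L[ℝ] W} (hΦ : Function.Bijective Φ)
    (h : ∀ A ∈ S, ∃ B ∈ S', B ∘L Φ = Φ ∘L A) {B : W →L[ℝ] W} (hB : B ∈ S') :
    ∃ A ∈ S, B ∘L Φ = Φ ∘L A := by
  let post : (V →L[ℝ] V) →ₗ[ℝ] (V →L[ℝ] W) :=
    { toFun := fun A ↦ Φ ∘L A
      map_add' := fun A B ↦ Φ.comp_add A B
      map_smul' := fun c A ↦ Φ.comp_smul c A }
  let pre : (W →L[ℝ] W) →ₗ[ℝ] (V →L[ℝ] W) :=
    { toFun := fun B ↦ B ∘L Φ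
      map_add' := fun A B ↦ ContinuousLinearMap.add_comp A B Φ
      map_smul' := fun c A ↦ ContinuousLinearMap.smul_comp c A Φ }
  have hpost : Function.Injective post := fun A B hAB ↦ by
    ext v; exact hΦ.1 (congrArg (fun C : V →L[ℝ] W ↦ C v) hAB)
  have hpre : Function.Injective pre := fun A B hAB ↦ by
    ext w
    obtain ⟨v, rfl⟩ := hΦ.2 w
    exact congrArg (fun C : V →L[ℝ] W ↦ C v) hAB
  have hle : S.map post ≤ S'.map pre := by
    rintro _ ⟨A, hA, rfl⟩
    obtain ⟨B, hB, hAB⟩ := h A hA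
    exact ⟨B, hB, hAB⟩
  have e1 : Module.finrank ℝ (S.map post) = Module.finrank ℝ S :=
    (Submodule.equivMapOfInjective post hpost S).finrank_eq.symm
  have e2 : Module.finrank ℝ (S'.map pre) = Module.finrank ℝ S' :=
    (Submodule.equivMapOfInjective pre hpre S').finrank_eq.symm
  have : FiniteDimensional ℝ (S'.map pre) := FiniteDimensional.of_finrank_pos (by omega)
  have heq : S.map post = S'.map pre := Submodule.eq_of_le_of_finrank_eq hle (by omega)
  have hmem : pre B ∈ S.map post := heq ▸ Submodule.mem_map_of_mem hB
  obtain ⟨A, hA, hAB⟩ := hmem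
  exact ⟨A, hA, hAB.symm⟩

end Conjugation

/-- The derivative of a curve in a subspace lies in the subspace. -/
theorem hasDerivAt_mem_of_eventually_mem {V : Type*} [NormedAddCommGroup V] [NormedSpace ℝ V]
    [FiniteDimensional ℝ V] {S : Submodule ℝ V} {c : ℝ → V} {c' : V} (hc : HasDerivAt c c' 0)
    (hS : ∀ᶠ t in 𝓝 (0 : ℝ), c t ∈ S) : c' ∈ S := by
  have h1 := hasDerivAt_iff_tendsto_slope.1 hc
  have hcl : IsClosed (S : Set V) := S.closed_of_finiteDimensional
  refine hcl.mem_of_tendsto h1 ?_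
  filter_upwards [hS.filter_mono nhdsWithin_le_nhds] with t ht
  rw [slope_def_module]
  exact S.smul_mem _ (S.sub_mem ht hS.self_of_nhds)

/-- The derivative of the conjugates of a curve `a` by a curve of units through `1`. -/
theorem hasDerivAt_inverse_mul_mul {R : Type*} [NormedRing R] [NormedAlgebra ℝ R] [CompleteSpace R]
    {G a : ℝ → R} {N a' : R} (hG : HasDerivAt G N 0) (hG0 : G 0 = 1) (ha : HasDerivAt a a' 0) :
    HasDerivAt (fun t ↦ Ring.inverse (G t) * (a t * G t)) (a' + a 0 * N - N * a 0) 0 := by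
  have hd : DifferentiableAt ℝ (fun t ↦ Ring.inverse (G t)) 0 := by
    have h1 : DifferentiableAt ℝ (Ring.inverse : R → R) (G 0) := by
      rw [hG0]; exact differentiableAt_inverse isUnit_one
    exact h1.comp (0 : ℝ) hG.differentiableAt
  have h2 : HasDerivAt (fun t ↦ Ring.inverse (G t)) (-N) 0 := by
    have hunit : ∀ᶠ t in 𝓝 (0 : ℝ), IsUnit (G t) :=
      hG.continuousAt.eventually_mem (Units.isOpen.mem_nhds (by rw [hG0]; exact isUnit_one))
    have hprod := hG.mul hd.hasDerivAt
    have hone : HasDerivAt (fun t ↦ G t * Ring.inverse (G t)) 0 0 :=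
      (hasDerivAt_const (0 : ℝ) (1 : R)).congr_of_eventuallyEq
        (hunit.mono fun t ht ↦ Ring.mul_inverse_cancel _ ht)
    have h := hprod.unique hone
    simp only [hG0, Ring.inverse_one, mul_one, one_mul] at h
    rw [← eq_neg_of_add_eq_zero_right h]
    exact hd.hasDerivAt
  have h3 := h2.mul (ha.mul hG)
  have h4 : -N * (a 0 * G 0) + Ring.inverse (G 0) * (a' * G 0 + a 0 * N) =
      a' + a 0 * N - N * a 0 := by
    rw [hG0, Ring.inverse_one]
    noncomm_ring
  exact h4 ▸ h3

variable {E : Type*} [NormedAddCommGroup E] [NormedSpace ℝ E] [FiniteDimensional ℝ E]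
  {M : Type*} [TopologicalSpace M] [ChartedSpace E M] [IsManifold 𝓘(ℝ, E) ∞ M]
  {Q : Π x : M, Submodule ℝ (EndT E x)} {X : Π x : M, TangentSpace 𝓘(ℝ, E) x}

/-- The Lie derivative of a section of `Q` along a quaternionic vector field lies in `Q`: it is the
derivative at `0` of the curve `dφ_t⁻¹ ∘ A ∘ dφ_t` in the fibre of `Q`. -/
theorem IsQuaternionicVF.chartLieDeriv_mem (hX : IsQuaternionicVF Q X)
    (hQ : IsAlmostQuaternionic Q) {A : Π x : M, EndT E x} (hA : SmoothEndOn A univ)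
    (hAQ : ∀ x, A x ∈ Q x) (x₀ : M) : chartLieDeriv x₀ X A ∈ Q x₀ := by
  obtain ⟨φ, ε, U, hx, hφ, hflow⟩ := hX.flow x₀
  set u₀ : E := extChartAt 𝓘(ℝ, E) x₀ x₀ with hu₀
  let G : ℝ → E →L[ℝ] E := fun t ↦ fderiv ℝ (fun u ↦ chartFlow x₀ φ (t, u)) u₀
  let a : ℝ → E →L[ℝ] E := fun t ↦ chartEnd x₀ A (chartFlow x₀ φ (t, u₀))
  set N : E →L[ℝ] E := fderiv ℝ (chartVF x₀ X) u₀ with hN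
  have hflow0 := hφ.eventually_hasDerivAt_chartFlow hx
  have hG : HasDerivAt G N 0 :=
    hasDerivAt_fderiv_of_timeDeriv (hφ.contDiffAt_chartFlow hx) hflow0
  have hp0 : chartFlow x₀ φ (0, u₀) = u₀ := by
    simp only [chartFlow, hu₀, extChartAt_to_inv, hφ.zero x₀ hx]
  have hG0 : G 0 = 1 := by
    have hev : (fun u ↦ chartFlow x₀ φ (0, u)) =ᶠ[𝓝 u₀] id := by
      have hU : ∀ᶠ u in 𝓝 u₀, (extChartAt 𝓘(ℝ, E) x₀).symm u ∈ U :=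
        (continuousAt_extChartAt_symm x₀).eventually_mem
          (by rw [extChartAt_to_inv]; exact hφ.isOpen.mem_nhds hx)
      filter_upwards [hU, extChartAt_target_mem_nhds (I := 𝓘(ℝ, E)) x₀] with u hu hut
      simp only [chartFlow, hφ.zero _ hu, (extChartAt 𝓘(ℝ, E) x₀).right_inv hut, id]
    exact hev.fderiv_eq.trans fderiv_id
  have ha : HasDerivAt a (fderiv ℝ (chartEnd x₀ A) u₀ (chartVF x₀ X u₀)) 0 := by
    have h1 : HasFDerivAt (chartEnd x₀ A) (fderiv ℝ (chartEnd x₀ A) u₀)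
        (chartFlow x₀ φ (0, u₀)) := by
      rw [hp0]; exact ((contDiffAt_chartEnd hA).differentiableAt (by simp)).hasFDerivAt
    exact h1.comp_hasDerivAt (0 : ℝ) hflow0.self_of_nhds
  have ha0 : a 0 = chartEnd x₀ A u₀ := by simp only [a, hp0]
  -- The derivative of the conjugated curve.
  let C : ℝ → E →L[ℝ] E := fun t ↦ Ring.inverse (G t) * (a t * G t)
  have hC : HasDerivAt C (chartLieDeriv x₀ X A) 0 := by
    have h1 := hasDerivAt_inverse_mul_mul hG hG0 ha
    rw [ha0] at h1
    exact h1
  have hunit : ∀ᶠ t in 𝓝 (0 : ℝ), IsUnit (G t) :=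
    hG.continuousAt.eventually_mem (Units.isOpen.mem_nhds (by rw [hG0]; exact isUnit_one))
  let S : Submodule ℝ (E →L[ℝ] E) := Q x₀
  have hCS : ∀ᶠ t in 𝓝 (0 : ℝ), C t ∈ S := by
    filter_upwards [hunit, hφ.eventually_mfderiv_eq hx, hφ.eventually_mem] with t htu ⟨hts, htG⟩ ht
    set y := φ t x₀ with hy
    set t₀ := trivializationAt E (TangentSpace 𝓘(ℝ, E) : M → Type _) x₀ with ht₀
    have hyt : y ∈ t₀.baseSet := by simpa [ht₀] using hts
    let Φ : TangentSpace 𝓘(ℝ, E) x₀ →L[ℝ] TangentSpace 𝓘(ℝ, E) y :=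
      mfderiv 𝓘(ℝ, E) 𝓘(ℝ, E) (φ t) x₀
    have hG' : ∀ v : TangentSpace 𝓘(ℝ, E) x₀,
      t₀.continuousLinearEquivAt ℝ y hyt (Φ v) = G t v := fun v ↦ htG v
    obtain ⟨g, hg⟩ := htu
    have hbij : Function.Bijective (G t) := by
      rw [← hg]
      exact (ContinuousLinearEquiv.ofUnit g).bijective
    have hΦ : Function.Bijective Φ := by
      have : (Φ : TangentSpace 𝓘(ℝ, E) x₀ → TangentSpace 𝓘(ℝ, E) y) =
          (t₀.continuousLinearEquivAt ℝ y hyt).symm ∘ (G t) := by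
        funext v
        exact ((ContinuousLinearEquiv.symm_apply_eq _).2 (hG' v).symm).symm
      rw [this]
      exact (t₀.continuousLinearEquivAt ℝ y hyt).symm.bijective.comp hbij
    obtain ⟨B, hB, hAB⟩ := exists_conj_mem (by rw [hQ.rank_eq]; norm_num)
      ((hQ.rank_eq x₀).trans (hQ.rank_eq y).symm) hΦ (hflow t ht x₀ hx) (hAQ y)
    have hay : a t = ContinuousLinearMap.inCoordinates E (TangentSpace 𝓘(ℝ, E)) E
        (TangentSpace 𝓘(ℝ, E)) x₀ y x₀ y (A y) := by
      have : (extChartAt 𝓘(ℝ, E) x₀).symm (chartFlow x₀ φ (t, u₀)) = y := by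
        simp only [chartFlow, hu₀, extChartAt_to_inv]
        exact (extChartAt 𝓘(ℝ, E) x₀).left_inv (by rw [extChartAt_source]; exact hts)
      simp only [a, chartEnd]
      rw [this]
    let B' : E →L[ℝ] E := B
    have hconj : a t * G t = G t * B' := by
      ext v
      have h1 : a t (G t v) = G t (B' v) := by
        rw [hay, ← hG' v]
        refine (inCoordinates_apply_trivializationAt hts (A y) (Φ v)).trans ?_
        have h2 := congrArg (fun T : TangentSpace 𝓘(ℝ, E) x₀ →L[ℝ] TangentSpace 𝓘(ℝ, E) y ↦
          t₀.continuousLinearEquivAt ℝ y hyt (T v)) hAB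
        exact h2.trans (hG' (B v))
      exact h1
    have hCB : C t = B' := by
      simp only [C]
      rw [hconj, ← mul_assoc, Ring.inverse_mul_cancel _ ⟨g, hg⟩, one_mul]
    rw [hCB]
    exact hB
  exact hasDerivAt_mem_of_eventually_mem hC hCS

end

/-! ### Lie derivatives of functions and connections -/

section

variable {E : Type*} [NormedAddCommGroup E] [NormedSpace ℝ E] [FiniteDimensional ℝ E]
  {M : Type*} [TopologicalSpace M] [ChartedSpace E M] [IsManifold 𝓘(ℝ, E) ∞ M]
  {X Y Z : Π x : M, TangentSpace 𝓘(ℝ, E) x}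

theorem mlieBracket_jacobi (hX : SmoothVF X) (hY : SmoothVF Y) (hZ : SmoothVF Z) (x : M) :
    mlieBracket 𝓘(ℝ, E) X (mlieBracket 𝓘(ℝ, E) Y Z) x =
      mlieBracket 𝓘(ℝ, E) (mlieBracket 𝓘(ℝ, E) X Y) Z x +
        mlieBracket 𝓘(ℝ, E) Y (mlieBracket 𝓘(ℝ, E) X Z) x := by
  have h2 : minSmoothness ℝ 2 ≤ ∞ := by
    rw [minSmoothness_of_isRCLikeNormedField]; exact WithTop.coe_le_coe.2 le_top
  have : IsManifold 𝓘(ℝ, E) (minSmoothness ℝ 3) M := by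
    rw [minSmoothness_of_isRCLikeNormedField]
    exact IsManifold.of_le (n := ∞) (WithTop.coe_le_coe.2 le_top)
  exact leibniz_identity_mlieBracket_apply ((hX x).of_le h2) ((hY x).of_le h2) ((hZ x).of_le h2)

variable [T2Space M]

/-- `[X, Y] f = X (Y f) - Y (X f)`. This is deduced from the Jacobi identity for `X`, `Y`, `f W`
with a vector field `W` which does not vanish at the given point. -/
theorem mvfderiv_mlieBracket (hX : SmoothVF X) (hY : SmoothVF Y) {f : M → ℝ}
    (hf : ContMDiff 𝓘(ℝ, E) 𝓘(ℝ, ℝ) ∞ f) (x : M) :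
    mvfderiv 𝓘(ℝ, E) f x (mlieBracket 𝓘(ℝ, E) X Y x) =
      mvfderiv 𝓘(ℝ, E) (fun y ↦ mvfderiv 𝓘(ℝ, E) f y (Y y)) x (X x) -
        mvfderiv 𝓘(ℝ, E) (fun y ↦ mvfderiv 𝓘(ℝ, E) f y (X y)) x (Y x) := by
  rcases subsingleton_or_nontrivial (TangentSpace 𝓘(ℝ, E) x) with h | h
  · rw [Subsingleton.elim (mlieBracket 𝓘(ℝ, E) X Y x) 0, Subsingleton.elim (X x) 0,
      Subsingleton.elim (Y x) 0]
    simp only [map_zero, sub_zero]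
  obtain ⟨w, hw⟩ := exists_ne (0 : TangentSpace 𝓘(ℝ, E) x)
  obtain ⟨W, hW, rfl⟩ := exists_smoothVF_eq x w
  have hd : ∀ {g : M → ℝ}, ContMDiff 𝓘(ℝ, E) 𝓘(ℝ, ℝ) ∞ g →
      ∀ y, MDifferentiableAt 𝓘(ℝ, E) 𝓘(ℝ, ℝ) g y := fun hg y ↦ (hg y).mdifferentiableAt (by simp)
  have hsmul : ∀ (V : Π x : M, TangentSpace 𝓘(ℝ, E) x), mlieBracket 𝓘(ℝ, E) V (f • W) =
      (fun y ↦ mvfderiv 𝓘(ℝ, E) f y (V y)) • W + f • mlieBracket 𝓘(ℝ, E) V W := fun V ↦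
    funext fun y ↦ mlieBracket_smul_right (hd hf y) (hW.mdifferentiableAt y)
  have hsmul2 : ∀ {U V : Π x : M, TangentSpace 𝓘(ℝ, E) x}, SmoothVF U → SmoothVF V →
      mlieBracket 𝓘(ℝ, E) U (mlieBracket 𝓘(ℝ, E) V (f • W)) x =
        mvfderiv 𝓘(ℝ, E) (fun y ↦ mvfderiv 𝓘(ℝ, E) f y (V y)) x (U x) • W x +
        mvfderiv 𝓘(ℝ, E) f x (V x) • mlieBracket 𝓘(ℝ, E) U W x +
        (mvfderiv 𝓘(ℝ, E) f x (U x) • mlieBracket 𝓘(ℝ, E) V W x +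
          f x • mlieBracket 𝓘(ℝ, E) U (mlieBracket 𝓘(ℝ, E) V W) x) := by
    intro U V hU hV
    have hVf := contMDiff_mvfderiv_apply hf hV
    have hVW := hV.mlieBracket hW
    rw [hsmul, mlieBracket_add_right ((hVf.smul_section hW x).mdifferentiableAt (by simp))
      ((hf.smul_section hVW x).mdifferentiableAt (by simp)),
      mlieBracket_smul_right (hd hVf x) (hW.mdifferentiableAt x),
      mlieBracket_smul_right (hd hf x) (hVW.mdifferentiableAt x)]
  have h1 := mlieBracket_jacobi hX hY (SmoothVF.smul hf hW) x
  change mlieBracket 𝓘(ℝ, E) X (mlieBracket 𝓘(ℝ, E) Y (f • W)) x =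
    mlieBracket 𝓘(ℝ, E) (mlieBracket 𝓘(ℝ, E) X Y) (f • W) x +
      mlieBracket 𝓘(ℝ, E) Y (mlieBracket 𝓘(ℝ, E) X (f • W)) x at h1
  rw [hsmul2 hX hY, hsmul2 hY hX, hsmul, mlieBracket_jacobi hX hY hW x] at h1
  simp only [Pi.add_apply, Pi.smul_apply'] at h1
  refine smul_left_injective ℝ hw ?_
  simp only
  linear_combination (norm := module) -h1

section LieDerivConnection

variable {D : Connection E M}

theorem lieDerivConnection_tensorial (hD : CovariantDerivative.ContMDiffCovariantDerivative D ∞)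
    (X : Π x : M, TangentSpace 𝓘(ℝ, E) x) (hZ : SmoothVF Z) (x : M) :
    TensorialAt 𝓘(ℝ, E) E (fun Y ↦ lieDerivConnection X D Y Z x) x := by
  have hDZ : SmoothEndOn (fun x ↦ D Z x) univ := hD.contMDiff.contMDiff (σ := Z) hZ.contMDiffOn
  refine ⟨fun {f Y} hf hY ↦ ?_, fun {Y Y'} hY hY' ↦ ?_⟩
  · have h1 : (fun y ↦ D Z y ((f • Y) y)) = f • fun y ↦ D Z y (Y y) := by
      funext y; simp only [Pi.smul_apply', map_smul]
    rw [lieDerivConnection, h1, mlieBracket_smul_right hf (hDZ.mdifferentiableAt_apply hY),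
      mlieBracket_smul_right hf hY, lieDerivConnection]
    simp only [Pi.smul_apply', map_smul, map_add]
    module
  · have h1 : (fun y ↦ D Z y ((Y + Y') y)) = (fun y ↦ D Z y (Y y)) + fun y ↦ D Z y (Y' y) := by
      funext y; simp only [Pi.add_apply, map_add]
    rw [lieDerivConnection, h1, mlieBracket_add_right (hDZ.mdifferentiableAt_apply hY)
      (hDZ.mdifferentiableAt_apply hY'), mlieBracket_add_right hY hY', lieDerivConnection,
      lieDerivConnection]
    simp only [Pi.add_apply, map_add]
    abel

/-- For a torsion-free connection, `L_X ∇` is symmetric, by the Jacobi identity. -/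
theorem lieDerivConnection_symm (hD : CovariantDerivative.ContMDiffCovariantDerivative D ∞)
    (hT : D.torsion = 0) (hX : SmoothVF X) (hY : SmoothVF Y) (hZ : SmoothVF Z) (x : M) :
    lieDerivConnection X D Y Z x = lieDerivConnection X D Z Y x := by
  have htor : ∀ {U V : Π x : M, TangentSpace 𝓘(ℝ, E) x}, SmoothVF U → SmoothVF V → ∀ y,
      D V y (U y) = D U y (V y) + mlieBracket 𝓘(ℝ, E) U V y := fun {U V} hU hV y ↦
    sub_eq_iff_eq_add'.1 ((CovariantDerivative.torsion_eq_zero_iff D).1 hT (hU.mdifferentiableAt y)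
      (hV.mdifferentiableAt y))
  have h1 : (fun y ↦ D Z y (Y y)) = (fun y ↦ D Y y (Z y)) + mlieBracket 𝓘(ℝ, E) Y Z :=
    funext fun y ↦ htor hY hZ y
  rw [lieDerivConnection, lieDerivConnection, h1, mlieBracket_add_right
    ((hZ.covDeriv hD hY).mdifferentiableAt x) ((hY.mlieBracket hZ).mdifferentiableAt x),
    mlieBracket_jacobi hX hY hZ]
  have h2 : D (mlieBracket 𝓘(ℝ, E) X Z) x (Y x) = D Y x (mlieBracket 𝓘(ℝ, E) X Z x) +
      mlieBracket 𝓘(ℝ, E) Y (mlieBracket 𝓘(ℝ, E) X Z) x := htor hY (hX.mlieBracket hZ) x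
  have h3 : D Z x (mlieBracket 𝓘(ℝ, E) X Y x) = D (mlieBracket 𝓘(ℝ, E) X Y) x (Z x) +
      mlieBracket 𝓘(ℝ, E) (mlieBracket 𝓘(ℝ, E) X Y) Z x := htor (hX.mlieBracket hY) hZ x
  rw [h2, h3]
  abel

/-- `L_X ∇` as a symmetric bilinear map on a tangent space. -/
theorem exists_lieDerivConnection_eq (hD : CovariantDerivative.ContMDiffCovariantDerivative D ∞)
    (hT : D.torsion = 0) (hX : SmoothVF X) (x : M) :
    ∃ T : TangentSpace 𝓘(ℝ, E) x →L[ℝ] TangentSpace 𝓘(ℝ, E) x →L[ℝ] TangentSpace 𝓘(ℝ, E) x,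
      (∀ y z, T y z = T z y) ∧ ∀ Y Z : Π x : M, TangentSpace 𝓘(ℝ, E) x, SmoothVF Y → SmoothVF Z →
        lieDerivConnection X D Y Z x = T (Y x) (Z x) := by
  choose s hs hsx using fun v : TangentSpace 𝓘(ℝ, E) x ↦ exists_smoothVF_eq x v
  let Φ (v : TangentSpace 𝓘(ℝ, E) x) : TangentSpace 𝓘(ℝ, E) x →L[ℝ] TangentSpace 𝓘(ℝ, E) x :=
    TensorialAt.mkHom _ x (lieDerivConnection_tensorial hD X (hs v) x)
  have hΦ : ∀ (v) {Y : Π x : M, TangentSpace 𝓘(ℝ, E) x}, SmoothVF Y →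
      Φ v (Y x) = lieDerivConnection X D Y (s v) x := fun v Y hY ↦
    TensorialAt.mkHom_apply _ (hY.mdifferentiableAt x)
  have hsymm : ∀ v w, Φ v w = Φ w v := by
    intro v w
    have h1 := hΦ v (hs w)
    have h2 := hΦ w (hs v)
    rw [hsx] at h1 h2
    rw [h1, h2, lieDerivConnection_symm hD hT hX (hs w) (hs v)]
  have hmain : ∀ Y Z : Π x : M, TangentSpace 𝓘(ℝ, E) x, SmoothVF Y → SmoothVF Z →
      lieDerivConnection X D Y Z x = Φ (Y x) (Z x) := by
    intro Y Z hY hZ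
    rw [hΦ _ hZ, lieDerivConnection_symm hD hT hX hZ (hs _)]
    have h := lieDerivConnection_tensorial hD X hZ x
    rw [← TensorialAt.mkHom_apply h (hY.mdifferentiableAt x),
      ← TensorialAt.mkHom_apply h ((hs (Y x)).mdifferentiableAt x), hsx]
  refine ⟨LinearMap.toContinuousLinearMap
    { toFun := Φ, map_add' := fun v w ↦ ?_, map_smul' := fun c v ↦ ?_ }, hsymm, hmain⟩
  · refine ContinuousLinearMap.ext fun u ↦ ?_
    rw [hsymm, map_add, hsymm u v, hsymm u w, add_apply]
  · refine ContinuousLinearMap.ext fun u ↦ ?_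
    rw [hsymm, map_smul, hsymm u v]
    rfl

end LieDerivConnection

/-! ### Derivations of the quaternionic structure -/

/-- The Lie derivative of a section `A` of `End(TM)`, given at each point by the formula in the
preferred chart there. -/
def lieDerivEnd (X : Π x : M, TangentSpace 𝓘(ℝ, E) x) (A : Π x : M, EndT E x) (x : M) :
    EndT E x :=
  chartLieDeriv (E := E) x X A

omit [T2Space M] in
theorem lieDerivEnd_apply {A : Π x : M, EndT E x} (hA : SmoothEndOn A univ) (hZ : SmoothVF Z)
    (x : M) : lieDerivEnd X A x (Z x) =
      mlieBracket 𝓘(ℝ, E) X (fun x ↦ A x (Z x)) x - A x (mlieBracket 𝓘(ℝ, E) X Z x) :=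
  (lieDerivEnd_eq_chart X hA hZ).symm

theorem smoothEndOn_lieDerivEnd (hX : SmoothVF X) {A : Π x : M, EndT E x}
    (hA : SmoothEndOn A univ) : SmoothEndOn (lieDerivEnd X A) univ := by
  refine smoothEndOn_univ_of_apply fun Z hZ ↦ ?_
  have h : (fun x ↦ lieDerivEnd X A x (Z x)) = fun x ↦
      mlieBracket 𝓘(ℝ, E) X (fun x ↦ A x (Z x)) x - A x (mlieBracket 𝓘(ℝ, E) X Z x) :=
    funext fun x ↦ lieDerivEnd_apply hA hZ x
  rw [h]
  exact (hX.mlieBracket (hA.apply hZ)).sub (hA.apply (hX.mlieBracket hZ))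

theorem smoothEndOn_endDeriv {D : Connection E M}
    (hD : CovariantDerivative.ContMDiffCovariantDerivative D ∞) (hY : SmoothVF Y)
    {A : Π x : M, EndT E x} (hA : SmoothEndOn A univ) :
    SmoothEndOn (fun x ↦ endDeriv D A hA x (Y x)) univ := by
  refine smoothEndOn_univ_of_apply fun Z hZ ↦ ?_
  have h : (fun x ↦ endDeriv D A hA x (Y x) (Z x)) = fun x ↦
      D (fun y ↦ A y (Z y)) x (Y x) - A x (D Z x (Y x)) :=
    funext fun x ↦ endDeriv_apply D hA _ (hZ.mdifferentiableAt x)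
  rw [h]
  exact (hY.covDeriv hD (hA.apply hZ)).sub (hA.apply (hY.covDeriv hD hZ))

/-- The commutator formula `[(L_X ∇)_Y, A] = L_X (∇_Y A) - ∇_{[X, Y]} A - ∇_Y (L_X A)`. -/
theorem lieDerivConnection_commutator {D : Connection E M}
    (hD : CovariantDerivative.ContMDiffCovariantDerivative D ∞) (hX : SmoothVF X) (hY : SmoothVF Y)
    (hZ : SmoothVF Z) {A : Π x : M, EndT E x} (hA : SmoothEndOn A univ) (x : M) :
    lieDerivConnection X D Y (fun x ↦ A x (Z x)) x - A x (lieDerivConnection X D Y Z x) =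
      lieDerivEnd X (fun x ↦ endDeriv D A hA x (Y x)) x (Z x) -
        endDeriv D A hA x (mlieBracket 𝓘(ℝ, E) X Y x) (Z x) -
        endDeriv D (lieDerivEnd X A) (smoothEndOn_lieDerivEnd hX hA) x (Y x) (Z x) := by
  have hB := smoothEndOn_endDeriv hD hY hA
  have hL := smoothEndOn_lieDerivEnd hX hA
  have hXZ := hX.mlieBracket hZ
  have hDZ := hY.covDeriv hD hZ
  set B : Π x : M, EndT E x := fun x ↦ endDeriv D A hA x (Y x) with hBdef
  set L : Π x : M, EndT E x := lieDerivEnd X A with hLdef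
  have hBapp : ∀ {W : Π x : M, TangentSpace 𝓘(ℝ, E) x}, SmoothVF W → ∀ y,
      D (fun y ↦ A y (W y)) y (Y y) = B y (W y) + A y (D W y (Y y)) := fun hW y ↦
    (sub_eq_iff_eq_add.1 (endDeriv_apply D hA (Y y) (hW.mdifferentiableAt y)).symm)
  have hLapp : ∀ {W : Π x : M, TangentSpace 𝓘(ℝ, E) x}, SmoothVF W → ∀ y,
      mlieBracket 𝓘(ℝ, E) X (fun y ↦ A y (W y)) y = L y (W y) + A y (mlieBracket 𝓘(ℝ, E) X W y) :=
    fun hW y ↦ sub_eq_iff_eq_add.1 (lieDerivEnd_apply hA hW y).symm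
  -- `[X, ∇_Y (A Z)]`
  have h1 : mlieBracket 𝓘(ℝ, E) X (fun y ↦ D (fun y ↦ A y (Z y)) y (Y y)) x =
      lieDerivEnd X B x (Z x) + B x (mlieBracket 𝓘(ℝ, E) X Z x) +
        (L x (D Z x (Y x)) + A x (mlieBracket 𝓘(ℝ, E) X (fun y ↦ D Z y (Y y)) x)) := by
    have e : (fun y ↦ D (fun y ↦ A y (Z y)) y (Y y)) =
        (fun y ↦ B y (Z y)) + fun y ↦ A y (D Z y (Y y)) := funext fun y ↦ hBapp hZ y
    rw [e, mlieBracket_add_right ((hB.apply hZ).mdifferentiableAt x)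
      ((hA.apply hDZ).mdifferentiableAt x), hLapp hDZ x]
    congr 1
    exact sub_eq_iff_eq_add.1 (lieDerivEnd_apply hB hZ x).symm
  -- `∇_{[X, Y]} (A Z)`
  have h2 : D (fun y ↦ A y (Z y)) x (mlieBracket 𝓘(ℝ, E) X Y x) =
      endDeriv D A hA x (mlieBracket 𝓘(ℝ, E) X Y x) (Z x) +
        A x (D Z x (mlieBracket 𝓘(ℝ, E) X Y x)) :=
    sub_eq_iff_eq_add.1 (endDeriv_apply D hA _ (hZ.mdifferentiableAt x)).symm
  -- `∇_Y [X, A Z]`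
  have h3 : D (mlieBracket 𝓘(ℝ, E) X (fun y ↦ A y (Z y))) x (Y x) =
      endDeriv D L hL x (Y x) (Z x) + L x (D Z x (Y x)) + (B x (mlieBracket 𝓘(ℝ, E) X Z x) +
        A x (D (mlieBracket 𝓘(ℝ, E) X Z) x (Y x))) := by
    have e : mlieBracket 𝓘(ℝ, E) X (fun y ↦ A y (Z y)) =
        (fun y ↦ L y (Z y)) + fun y ↦ A y (mlieBracket 𝓘(ℝ, E) X Z y) :=
      funext fun y ↦ hLapp hZ y
    rw [e, D.isCovariantDerivativeOnUniv.add ((hL.apply hZ).mdifferentiableAt x)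
      ((hA.apply hXZ).mdifferentiableAt x), add_apply, hBapp hXZ x]
    congr 1
    exact sub_eq_iff_eq_add.1 (endDeriv_apply D hL _ (hZ.mdifferentiableAt x)).symm
  rw [lieDerivConnection, h1, h2, h3, lieDerivConnection, map_sub, map_sub]
  abel

end

section

variable {E : Type*} [NormedAddCommGroup E] [NormedSpace ℝ E] [FiniteDimensional ℝ E]
  {M : Type*} [TopologicalSpace M] [T2Space M] [ChartedSpace E M] [IsManifold 𝓘(ℝ, E) ∞ M]
  {X Y Z : Π x : M, TangentSpace 𝓘(ℝ, E) x} {Q : Π x : M, Submodule ℝ (EndT E x)}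
  {D : Connection E M}

theorem IsQuaternionicVF.lieDerivEnd_mem (hX : IsQuaternionicVF Q X)
    (hQ : IsAlmostQuaternionic Q) {A : Π x : M, EndT E x} (hA : SmoothEndOn A univ)
    (hAQ : ∀ x, A x ∈ Q x) (x : M) : lieDerivEnd X A x ∈ Q x :=
  hX.chartLieDeriv_mem hQ hA hAQ x

/-- For a quaternionic connection and a quaternionic vector field, `(L_X ∇)_Y` is a derivation of
`Q`. -/
theorem IsQuaternionicConnection.lieDeriv_commutator_mem (hD : IsQuaternionicConnection Q D)
    (hQ : IsAlmostQuaternionic Q) (hX : IsQuaternionicVF Q X) {x : M}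
    {T : TangentSpace 𝓘(ℝ, E) x →L[ℝ] TangentSpace 𝓘(ℝ, E) x →L[ℝ] TangentSpace 𝓘(ℝ, E) x}
    (hT : ∀ Y Z : Π x : M, TangentSpace 𝓘(ℝ, E) x, SmoothVF Y → SmoothVF Z →
      lieDerivConnection X D Y Z x = T (Y x) (Z x)) (y : TangentSpace 𝓘(ℝ, E) x)
    {A₀ : EndT E x} (hA₀ : A₀ ∈ Q x) : T y ∘L A₀ - A₀ ∘L T y ∈ Q x := by
  obtain ⟨A, hA, hAQ, rfl⟩ := hQ.exists_section_eq hA₀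
  obtain ⟨Y, hY, rfl⟩ := exists_smoothVF_eq x y
  have h : T (Y x) ∘L A x - A x ∘L T (Y x) =
      lieDerivEnd X (fun x ↦ endDeriv D A hA x (Y x)) x -
        endDeriv D A hA x (mlieBracket 𝓘(ℝ, E) X Y x) -
        endDeriv D (lieDerivEnd X A) (smoothEndOn_lieDerivEnd hX.smooth hA) x (Y x) := by
    refine ContinuousLinearMap.ext fun z ↦ ?_
    obtain ⟨Z, hZ, rfl⟩ := exists_smoothVF_eq x z
    have h := lieDerivConnection_commutator hD.smooth hX.smooth hY hZ hA x
    rw [hT Y Z hY hZ, hT Y _ hY (hA.apply hZ)] at h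
    exact h
  rw [h]
  exact sub_mem (sub_mem
    (hX.lieDerivEnd_mem hQ (smoothEndOn_endDeriv hD.smooth hY hA)
      (fun x ↦ hD.preserves A hA hAQ x _) x)
    (hD.preserves A hA hAQ x _))
    (hD.preserves _ _ (fun x ↦ hX.lieDerivEnd_mem hQ hA hAQ x) x _)

/-! ### Parallel volume elements -/

theorem mvfderiv_sum_apply {ι : Type*} {s : Finset ι} {g : ι → M → ℝ}
    (hg : ∀ i, ContMDiff 𝓘(ℝ, E) 𝓘(ℝ, ℝ) ∞ (g i)) (x : M) (v : TangentSpace 𝓘(ℝ, E) x) :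
    mvfderiv 𝓘(ℝ, E) (fun y ↦ ∑ i ∈ s, g i y) x v = ∑ i ∈ s, mvfderiv 𝓘(ℝ, E) (g i) x v := by
  classical
  induction s using Finset.induction_on with
  | empty =>
    simp only [Finset.sum_empty]
    rw [mvfderiv_const]
    rfl
  | insert a s ha ih =>
    have h : (fun y ↦ ∑ i ∈ insert a s, g i y) = g a + fun y ↦ ∑ i ∈ s, g i y := by
      funext y; rw [Finset.sum_insert ha]; rfl
    rw [h, mvfderiv_add ((hg a x).mdifferentiableAt (by simp))
      ((ContMDiff.sum fun i _ ↦ hg i) x |>.mdifferentiableAt (by simp)), Finset.sum_insert ha,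
      ← ih, add_apply]

/-- If a volume element is parallel for `∇` and invariant under `X`, then `(L_X ∇)_Y` is trace-free:
compare the second derivatives `X (Y (ν(Y₁, …, Y_m)))` and `Y (X (ν(Y₁, …, Y_m)))`. -/
theorem IsVolumeElement.tr_lieDerivConnection_eq_zero {ν : TopForm E M} (hν : IsVolumeElement ν)
    (hD : CovariantDerivative.ContMDiffCovariantDerivative D ∞) (hX : SmoothVF X)
    (hpar : ∀ e : Fin (Module.finrank ℝ E) → Π x : M, TangentSpace 𝓘(ℝ, E) x,
      (∀ i, SmoothVF (e i)) → ∀ x v, mvfderiv 𝓘(ℝ, E) (fun y ↦ ν y (fun i ↦ e i y)) x v =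
        ∑ i, ν x (Function.update (fun j ↦ e j x) i (D (e i) x v)))
    (hinv : ∀ e : Fin (Module.finrank ℝ E) → Π x : M, TangentSpace 𝓘(ℝ, E) x,
      (∀ i, SmoothVF (e i)) → ∀ x, lieDerivForm X ν e x = 0) {x : M}
    {T : TangentSpace 𝓘(ℝ, E) x →L[ℝ] TangentSpace 𝓘(ℝ, E) x →L[ℝ] TangentSpace 𝓘(ℝ, E) x}
    (hT : ∀ Y Z : Π x : M, TangentSpace 𝓘(ℝ, E) x, SmoothVF Y → SmoothVF Z →
      lieDerivConnection X D Y Z x = T (Y x) (Z x)) (y : TangentSpace 𝓘(ℝ, E) x) :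
    tr (T y) = 0 := by
  obtain ⟨Y, hY, rfl⟩ := exists_smoothVF_eq x y
  obtain ⟨e, he, he0⟩ := hν.exists_frame x
  have hinv' : ∀ e : Fin (Module.finrank ℝ E) → Π x : M, TangentSpace 𝓘(ℝ, E) x,
      (∀ i, SmoothVF (e i)) → ∀ x, mvfderiv 𝓘(ℝ, E) (fun y ↦ ν y (fun i ↦ e i y)) x (X x) =
        ∑ i, ν x (Function.update (fun j ↦ e j x) i (mlieBracket 𝓘(ℝ, E) X (e i) x)) :=
    fun e he x ↦ sub_eq_zero.1 (hinv e he x)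
  -- The functions `ν(e₁, …, Z, …, e_m)` with `Z` in the slot `i`.
  have hupd : ∀ (i) (Z : Π x : M, TangentSpace 𝓘(ℝ, E) x) (y : M),
      (fun j ↦ Function.update e i Z j y) = Function.update (fun j ↦ e j y) i (Z y) := by
    intro i Z y
    funext j
    by_cases hj : j = i
    · subst hj; simp
    · simp [hj]
  have hsm : ∀ (i) {Z : Π x : M, TangentSpace 𝓘(ℝ, E) x}, SmoothVF Z →
      ∀ j, SmoothVF (Function.update e i Z j) := by
    intro i Z hZ j
    by_cases hj : j = i
    · subst hj; simpa using hZ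
    · simpa [hj] using he j
  -- The derivative of `ν(e₁, …, Z, …, e_m)` by a derivation `δ` of the arguments.
  have hsplit : ∀ (i) (Z : Π x : M, TangentSpace 𝓘(ℝ, E) x)
      (δ : (Π x : M, TangentSpace 𝓘(ℝ, E) x) → TangentSpace 𝓘(ℝ, E) x),
      ∑ j, ν x (Function.update (fun k ↦ Function.update e i Z k x) j
          (δ (Function.update e i Z j))) =
        ν x (Function.update (fun k ↦ e k x) i (δ Z)) +
          ∑ j ∈ Finset.univ.erase i, ν x (Function.update
            (Function.update (fun k ↦ e k x) i (Z x)) j (δ (e j))) := by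
    intro i Z δ
    rw [← Finset.add_sum_erase _ _ (Finset.mem_univ i), hupd]
    congr 1
    · simp
    · refine Finset.sum_congr rfl fun j hj ↦ ?_
      rw [Function.update_of_ne (Finset.ne_of_mem_erase hj)]
  have hDe : ∀ i, SmoothVF (fun x ↦ D (e i) x (Y x)) := fun i ↦ hY.covDeriv hD (he i)
  have hLe : ∀ i, SmoothVF (mlieBracket 𝓘(ℝ, E) X (e i)) := fun i ↦ hX.mlieBracket (he i)
  have hcomm := mvfderiv_mlieBracket hX hY (hν.smooth e he) x
  simp only [hinv' e he] at hcomm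
  simp only [hpar e he] at hcomm
  rw [mvfderiv_sum_apply fun i ↦ hν.contMDiff_apply_update he i (hDe i),
    mvfderiv_sum_apply fun i ↦ hν.contMDiff_apply_update he i (hLe i)] at hcomm
  have h1 : ∀ i, mvfderiv 𝓘(ℝ, E) (fun y ↦ ν y (Function.update (fun j ↦ e j y) i
      (D (e i) y (Y y)))) x (X x) =
        ν x (Function.update (fun k ↦ e k x) i
          (mlieBracket 𝓘(ℝ, E) X (fun x ↦ D (e i) x (Y x)) x)) +
          ∑ j ∈ Finset.univ.erase i, ν x (Function.update
            (Function.update (fun k ↦ e k x) i (D (e i) x (Y x))) j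
              (mlieBracket 𝓘(ℝ, E) X (e j) x)) := by
    intro i
    have h := hinv' (Function.update e i (fun x ↦ D (e i) x (Y x))) (hsm i (hDe i)) x
    rw [hsplit i _ (fun Z ↦ mlieBracket 𝓘(ℝ, E) X Z x)] at h
    simp only [hupd] at h
    exact h
  have h2 : ∀ i, mvfderiv 𝓘(ℝ, E) (fun y ↦ ν y (Function.update (fun j ↦ e j y) i
      (mlieBracket 𝓘(ℝ, E) X (e i) y))) x (Y x) =
        ν x (Function.update (fun k ↦ e k x) i (D (mlieBracket 𝓘(ℝ, E) X (e i)) x (Y x))) +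
          ∑ j ∈ Finset.univ.erase i, ν x (Function.update
            (Function.update (fun k ↦ e k x) i (mlieBracket 𝓘(ℝ, E) X (e i) x)) j
              (D (e j) x (Y x))) := by
    intro i
    have h := hpar (Function.update e i (mlieBracket 𝓘(ℝ, E) X (e i))) (hsm i (hLe i)) x (Y x)
    rw [hsplit i _ (fun Z ↦ D Z x (Y x))] at h
    simp only [hupd] at h
    exact h
  -- The mixed terms agree, by exchanging the two slots.
  have h3 : ∑ i, ∑ j ∈ Finset.univ.erase i, ν x (Function.update
      (Function.update (fun k ↦ e k x) i (D (e i) x (Y x))) j (mlieBracket 𝓘(ℝ, E) X (e j) x)) =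
      ∑ i, ∑ j ∈ Finset.univ.erase i, ν x (Function.update
        (Function.update (fun k ↦ e k x) i (mlieBracket 𝓘(ℝ, E) X (e i) x)) j
          (D (e j) x (Y x))) := by
    rw [Finset.sum_comm' (t' := Finset.univ) (s' := fun j ↦ Finset.univ.erase j)
      (by simp [ne_comm])]
    refine Finset.sum_congr rfl fun i _ ↦ Finset.sum_congr rfl fun j hj ↦ ?_
    rw [Function.update_comm (Finset.ne_of_mem_erase hj)]
  have h4 : ∑ i, ν x (Function.update (fun k ↦ e k x) i (T (Y x) (e i x))) =
      tr (T (Y x)) * ν x (fun k ↦ e k x) :=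
    sum_apply_update (V := TangentSpace 𝓘(ℝ, E) x) (ν x) (T (Y x)) (fun k ↦ e k x)
  simp only [h1, h2, Finset.sum_add_distrib, h3] at hcomm
  simp only [← hT Y _ hY (he _), lieDerivConnection, AlternatingMap.map_update_sub,
    Finset.sum_sub_distrib] at h4
  refine (mul_eq_zero.1 (h4.symm.trans ?_)).resolve_right he0
  linear_combination -hcomm

/-- If a volume element is parallel for a quaternionic connection `∇` and invariant under a
quaternionic vector field `X`, then `L_X ∇ = 0`. -/
theorem IsQuaternionicConnection.lieDerivConnection_eq_zero (hD : IsQuaternionicConnection Q D)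
    (hQ : IsAlmostQuaternionic Q) (hX : IsQuaternionicVF Q X) {ν : TopForm E M}
    (hν : IsVolumeElement ν)
    (hpar : ∀ e : Fin (Module.finrank ℝ E) → Π x : M, TangentSpace 𝓘(ℝ, E) x,
      (∀ i, SmoothVF (e i)) → ∀ x v, mvfderiv 𝓘(ℝ, E) (fun y ↦ ν y (fun i ↦ e i y)) x v =
        ∑ i, ν x (Function.update (fun j ↦ e j x) i (D (e i) x v)))
    (hinv : ∀ e : Fin (Module.finrank ℝ E) → Π x : M, TangentSpace 𝓘(ℝ, E) x,
      (∀ i, SmoothVF (e i)) → ∀ x, lieDerivForm X ν e x = 0)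
    (hY : SmoothVF Y) (hZ : SmoothVF Z) (x : M) : lieDerivConnection X D Y Z x = 0 := by
  obtain ⟨T, hTs, hT⟩ := exists_lieDerivConnection_eq hD.smooth hD.torsion_free hX.smooth x
  obtain ⟨⟨I, J, K⟩, h, hspan⟩ := hQ.exists_triple x
  have := hQ.nontrivial x
  have hder : ∀ y, ∀ A ∈ ({I, J, K} : Set (EndT E x)),
      T y ∘L A - A ∘L T y ∈ Submodule.span ℝ {I, J, K} := by
    intro y A hA
    have hm := hD.lieDeriv_commutator_mem hQ hX hT y (A₀ := A)
      (by rw [hspan]; exact Submodule.subset_span hA)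
    rw [hspan] at hm
    exact hm
  obtain ⟨ξ, hξ⟩ := h.eq_correction T hTs hder
  have hξ0 : ∀ y, ξ y = 0 := by
    intro y
    have h1 := hν.tr_lieDerivConnection_eq_zero hD.smooth hX.smooth hpar hinv hT y
    rw [hξ] at h1
    have h2 := (h.tr_correction ξ y).symm.trans h1
    exact (mul_eq_zero.1 h2).resolve_left (by positivity)
  rw [hT Y Z hY hZ, hξ, correction_apply]
  simp only [hξ0, zero_smul, add_zero, sub_zero]

end

end Quaternionic

end

theorem corollary4p3 {E : Type*} [NormedAddCommGroup E] [NormedSpace ℝ E] [FiniteDimensional ℝ E]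
    {M : Type*} [TopologicalSpace M] [T2Space M] [ChartedSpace E M] [IsManifold 𝓘(ℝ, E) ∞ M]
    (Q : Π x : M, Submodule ℝ (Quaternionic.EndT E x))
    (hQ : Quaternionic.IsQuaternionicStructure Q)
    (X : Π x : M, TangentSpace 𝓘(ℝ, E) x) (hX : Quaternionic.IsQuaternionicVF Q X)
    (hν : ∃ ν : Quaternionic.TopForm E M, Quaternionic.IsVolumeElement ν ∧
      ∀ Y : Fin (Module.finrank ℝ E) → Π x : M, TangentSpace 𝓘(ℝ, E) x,
        (∀ i, Quaternionic.SmoothVF (Y i)) → ∀ x, Quaternionic.lieDerivForm X ν Y x = 0) :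
    ∃ D : Quaternionic.Connection E M, Quaternionic.IsQuaternionicConnection Q D ∧
      ∀ Y Z : Π x : M, TangentSpace 𝓘(ℝ, E) x,
        Quaternionic.SmoothVF Y → Quaternionic.SmoothVF Z →
          ∀ x, Quaternionic.lieDerivConnection X D Y Z x = 0 := by
  obtain ⟨ν, hν, hinv⟩ := hν
  obtain ⟨D, hD⟩ := hQ.exists_connection
  have hα : ∀ Y : Π x : M, TangentSpace 𝓘(ℝ, E) x, Quaternionic.SmoothVF Y →
      ContMDiff 𝓘(ℝ, E) 𝓘(ℝ, ℝ) ∞ (fun x ↦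
        (((Module.finrank ℝ E : ℝ) + 4)⁻¹ • hν.connectionForm D x) (Y x)) := fun Y hY ↦
    contMDiff_const.mul (hν.contMDiff_connectionForm hD.smooth hY)
  have hD' := hD.addOneForm_correction hQ.almost _ hα
  exact ⟨_, hD', fun Y Z hY hZ x ↦ hD'.lieDerivConnection_eq_zero hQ.almost hX hν
    (fun e he x v ↦ hν.parallel_addOneForm_correction D hQ.almost he x v) hinv hY hZ x⟩
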